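/- Let $n\ge 1$, and let $\mathcal P^n=\{[z_1:\dots:z_{n+2}]\in\mathbb P^{n+1}_{\mathbb C}\mid \sum_i z_i=0,\ z_i\neq 0\}$ be the $n$-dimensional pair of pants, with the Fubini–Study form. Let $\overline M_0=\{u\in\mathbb C^{n+2}\mid u_1\cdots u_{n+2}=1,\ u_1+\cdots+u_{n+2}=0\}$, and let $p:\overline M_0\to\mathcal P^n$ be the $(n+2)$-fold covering $u\mapsto[z_1:\dots:z_{n+1}:1]$, $z_i=u_i\cdot u_1\cdots u_{n+1}$. Let $\operatorname{Arg}:\overline M_0\to\mathbb R^{n+1}/2\pi\mathbb Z^{n+1}$, $u\mapsto(\arg u_1,\dots,\arg u_{n+1})$. **Thimbles.** Let $U_1\subset\mathcal P^n$ be the set of points $[z_1:z_2:\dots:z_{n+1}:1]$ with $z_2,\dots,z_{n+1}$ real and positive. For a solution $\zeta$ of $\zeta^{n+2}=(-1)^{n+1}(n+1)^{n+1}$, let $U_\zeta$ be the connected component of $p^{-1}(U_1)$ that contains a point with $u_1=\zeta$. **Zonotope.** Let $f_i=e_i-\frac1{n+2}\sum_{j=1}^{n+1}e_j\in\mathbb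 R^{n+1}$, and let $Z_{n+2}\subset\mathbb R^{n+1}$ be the zonotope generated by $\pi f_1,\dots,\pi f_{n+1},-\pi f_1-\dots-\pi f_{n+1}$, i.e. the Minkowski sum of the segments from $0$ to these vectors. It is centred at the origin. **Lagrangian spheres.** Let $S^n$ be the unit sphere in $\{x\in\mathbb R^{n+2}\mid\sum_i x_i=0\}$ and let $H=\{\sum_i z_i=0\}\subset\mathbb P^{n+1}_{\mathbb C}$. Fix a Weinstein neighbourhood of the double cover $S^n\to H_{\mathbb R}$, $x\mapsto[x]$: a smooth map $\Phi$ from a disc bundle in $T^*S^n$ to $H$ that restricts to $x\mapsto[x]$ on the zero section and pulls the Fubini–Study form back to the canonical symplectic form. Fix also a smooth function $f$ on $S^n$ whose gradient for the round metric has positive $j$-th component at each point of $S^n$ with $x_j=0$, for every $j$ (for example $f=\sum_j g(x_j)$ with $g$ smooth and odd and $g'$ strictly decreasing on $[0,\infty)$). For small $\varepsilon>0$, Sheridan's Lagrangian immersion $i_\varepsilon:S^n\to\mathcal P^n$ is the composition of $\Phi$ with the graph of $\varepsilon\,df$. Its pull-back by $p$ is the union of the images of its $n+2$ continuous lifts $S^n\to\overline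 M_0$; $L_{n+2}$ is the image of the lift whose argument projection is close to the image of the boundary $\partial Z_{n+2}$. **Statement.** 1. For every solution $\zeta$ of $\zeta^{n+2}=(-1)^{n+1}(n+1)^{n+1}$ there is exactly one such component $U_\zeta$, and $\operatorname{Arg}(U_\zeta)$ is the single point $(\arg\zeta,\arg\zeta+\pi,\dots,\arg\zeta+\pi)$. If $\arg\zeta\neq\pm\frac{n+1}{n+2}\pi$ (with $\arg\zeta\in(-\pi,\pi]$), this point does not lie in the image of $Z_{n+2}$ in $\mathbb R^{n+1}/2\pi\mathbb Z^{n+1}$. 2. There is $\delta_0>0$, depending only on $n$, such that for all $\Phi$ and $f$ as above and all $\delta\in(0,\delta_0]$ there is $\varepsilon_0>0$ with the following property for every $\varepsilon\in(0,\varepsilon_0)$. The map $i_\varepsilon$ is defined, has image in $\mathcal P^n$, and has exactly one continuous lift $\sigma:S^n\to\overline M_0$ with $\operatorname{Arg}(\sigma(S^n))$ contained in the open $\delta$-neighbourhood (for the maximum distance of coordinates) of the image of $\partial Z_{n+2}$. Its image $L_{n+2}=\sigma(S^n)$ satisfies $$U_\zeta\cap L_{n+2}=\varnothing$$ for every $\zeta$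 with $\zeta^{n+2}=(-1)^{n+1}(n+1)^{n+1}$ and $\arg\zeta\neq\pm\frac{n+1}{n+2}\pi$. -/

import Mathlib

open scoped Pointwise ContDiff LinearAlgebra.Projectivization

noncomputable section

namespace Pants

/-! ### The pair of pants, its cover, and the argument projection -/

/-- The `n`-dimensional pair of pants: points of `ℙ^{n+1}` with `z₁ + ⋯ + z_{n+2} = 0` and all
`z_i ≠ 0`.  The coordinate `z_i` of the mathematics is `z (i - 1)` here. -/
def pairOfPants (n : ℕ) : Set (ℙ ℂ (Fin (n + 2) → ℂ)) :=
  {P | ∃ (z : Fin (n + 2) → ℂ) (hz : z ≠ 0), P = Projectivization.mk ℂ z hz ∧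
    ∑ i, z i = 0 ∧ ∀ i, z i ≠ 0}

/-- The component of the real part of the pair of pants consisting of the points
`[z₁ : z₂ : ⋯ : z_{n+1} : 1]` with `z₂, …, z_{n+1}` real and positive. -/
def positivePart (n : ℕ) : Set (ℙ ℂ (Fin (n + 2) → ℂ)) :=
  {P | P ∈ pairOfPants n ∧ ∃ (z : Fin (n + 2) → ℂ) (hz : z ≠ 0),
    P = Projectivization.mk ℂ z hz ∧ z (Fin.last (n + 1)) = 1 ∧
    ∀ i, i ≠ 0 → ∃ r : ℝ, 0 < r ∧ z i = (r : ℂ)}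

/-- The torus hypersurface `{u₁ ⋯ u_{n+2} = 1, u₁ + ⋯ + u_{n+2} = 0}`. -/
def Mbar0 (n : ℕ) : Set (Fin (n + 2) → ℂ) :=
  {u | ∏ i, u i = 1 ∧ ∑ i, u i = 0}

/-- The homogeneous coordinates `(z₁, …, z_{n+1}, 1)` with `z_i = u_i · u₁ ⋯ u_{n+1}`. -/
def coverVec {n : ℕ} (u : Fin (n + 2) → ℂ) : Fin (n + 2) → ℂ :=
  Fin.snoc (α := fun _ => ℂ)
    (fun i : Fin (n + 1) => u i.castSucc * ∏ j : Fin (n + 1), u j.castSucc) 1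

lemma coverVec_ne_zero {n : ℕ} (u : Fin (n + 2) → ℂ) : coverVec u ≠ 0 := by
  intro h
  have := congrFun h (Fin.last (n + 1))
  simp [coverVec] at this

/-- The `(n+2)`-fold covering `u ↦ [z₁ : ⋯ : z_{n+1} : 1]`. -/
def cover {n : ℕ} (u : Fin (n + 2) → ℂ) : ℙ ℂ (Fin (n + 2) → ℂ) :=
  Projectivization.mk ℂ (coverVec u) (coverVec_ne_zero u)

/-- The inverse image in `Mbar0` of the positive part of the pair of pants. -/
def positivePreimage (n : ℕ) : Set (Fin (n + 2) → ℂ) :=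
  {u | u ∈ Mbar0 n ∧ cover u ∈ positivePart n}

/-- `C` is the component `U_ζ`: a connected component of the inverse image of the positive part
that contains a point with `u₁ = ζ`. -/
def IsThimble (n : ℕ) (ζ : ℂ) (C : Set (Fin (n + 2) → ℂ)) : Prop :=
  (∃ u ∈ positivePreimage n, C = connectedComponentIn (positivePreimage n) u) ∧
    ∃ u ∈ C, u 0 = ζ

/-- The argument projection `u ↦ (arg u₁, …, arg u_{n+1})` to `ℝ^{n+1} / 2πℤ^{n+1}`. -/
def argMap {n : ℕ} (u : Fin (n + 2) → ℂ) : Fin (n + 1) → Real.Angle :=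
  fun i => (Complex.arg (u i.castSucc) : Real.Angle)

/-- The projection `ℝ^{n+1} → ℝ^{n+1} / 2πℤ^{n+1}`. -/
def torusProj {n : ℕ} (θ : Fin (n + 1) → ℝ) : Fin (n + 1) → Real.Angle :=
  fun i => (θ i : Real.Angle)

/-- The vector `f_i = e_i - (1 / (n + 2)) ∑_j e_j` of `ℝ^{n+1}`. -/
def fVec (n : ℕ) (i : Fin (n + 1)) : Fin (n + 1) → ℝ :=
  Pi.single i 1 - (1 / ((n : ℝ) + 2)) • ∑ j : Fin (n + 1), Pi.single j (1 : ℝ)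

/-- The zonotope `Z_{n+2}` generated by `π f₁, …, π f_{n+1}, - π f₁ - ⋯ - π f_{n+1}`:
the Minkowski sum of the segments from `0` to these vectors. -/
def zonotope (n : ℕ) : Set (Fin (n + 1) → ℝ) :=
  (∑ i : Fin (n + 1), segment ℝ 0 (Real.pi • fVec n i)) +
    segment ℝ 0 (-∑ i : Fin (n + 1), Real.pi • fVec n i)

/-! ### Sheridan's immersed Lagrangian spheres -/

/-- The real hyperplane `{x₁ + ⋯ + x_{n+2} = 0}` of Euclidean space; its unit sphere is `S^n`,
and `x ↦ [x]` is the standard double cover of the real part of the hyperplane of `ℙ^{n+1}`. -/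
def RealHyp (n : ℕ) : Submodule ℝ (EuclideanSpace ℝ (Fin (n + 2))) where
  carrier := {x | ∑ i, x i = 0}
  add_mem' := by
    intro a b ha hb
    simp only [Set.mem_ofPred_eq, PiLp.add_apply, Finset.sum_add_distrib] at *
    rw [ha, hb, add_zero]
  zero_mem' := by simp
  smul_mem' := by
    intro c x hx
    simp only [Set.mem_ofPred_eq, PiLp.smul_apply, smul_eq_mul] at *
    rw [← Finset.mul_sum, hx, mul_zero]

/-- The `n`-sphere. -/
abbrev Sph (n : ℕ) : Type := Metric.sphere (0 : RealHyp n) 1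

/-- The standard Hermitian form, conjugate linear in the first variable. -/
def herm {n : ℕ} (a b : Fin (n + 2) → ℂ) : ℂ := ∑ i, (starRingEnd ℂ) (a i) * b i

/-- The Fubini–Study form `(i / 2) ∂∂̄ log |z|²`, pulled back to `ℂ^{n+2} ∖ {0}` and evaluated at
the point `z` on the tangent vectors `a` and `b`. -/
def fubiniStudy {n : ℕ} (z a b : Fin (n + 2) → ℂ) : ℝ :=
  (herm a b * herm z z - herm a z * herm z b).im / (herm z z).re ^ 2

/-- The disc bundle of radius `η` in `T S^n = T^* S^n` (for the round metric). -/
def discBundle (n : ℕ) (η : ℝ) : Set (RealHyp n × RealHyp n) :=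
  {q | ‖q.1‖ = 1 ∧ inner ℝ q.1 q.2 = 0 ∧ ‖q.2‖ < η}

/-- A Weinstein neighbourhood of the double cover `S^n → ℙ^n_ℝ ⊂ ℙ(H)`, where `H` is the complex
hyperplane `z₁ + ⋯ + z_{n+2} = 0`: a smooth map from a disc bundle in `T^* S^n` to `ℙ(H)` that
extends `x ↦ [x]` along the zero section and pulls the Fubini–Study form back to the canonical
symplectic form.  It is given in homogeneous coordinates, by a nowhere zero smooth map into `H`
with `(x, 0) ↦ x`; every smooth map to `ℙ(H)` as above has such coordinates, because the pull-back
of the tautological line bundle to the disc bundle is trivialised by `x` along the zero section.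
Smoothness is that of a germ on the ambient vector space along the disc bundle. -/
structure WeinsteinNbhd (n : ℕ) where
  /-- the radius of the disc bundle -/
  η : ℝ
  η_pos : 0 < η
  /-- the homogeneous coordinates of the map; only the germ along the disc bundle matters -/
  toFun : RealHyp n × RealHyp n → (Fin (n + 2) → ℂ)
  smooth : ∀ q ∈ discBundle n η, ContDiffAt ℝ ∞ toFun q
  ne_zero : ∀ q ∈ discBundle n η, toFun q ≠ 0
  mem_hyp : ∀ q ∈ discBundle n η, ∑ i, toFun q i = 0
  zero_section : ∀ x : RealHyp n, ‖x‖ = 1 →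
    ∀ i, toFun (x, 0) i = (((x : EuclideanSpace ℝ (Fin (n + 2))) i : ℝ) : ℂ)
  symplectic : ∀ q ∈ discBundle n η, ∀ s t : RealHyp n × RealHyp n,
    inner ℝ q.1 s.1 = 0 → inner ℝ s.1 q.2 + inner ℝ q.1 s.2 = 0 →
    inner ℝ q.1 t.1 = 0 → inner ℝ t.1 q.2 + inner ℝ q.1 t.2 = 0 →
    fubiniStudy (toFun q) (fderiv ℝ toFun q s) (fderiv ℝ toFun q t) =
      inner ℝ s.1 t.2 - inner ℝ t.1 s.2

/-- The gradient at `x ∈ S^n`, for the round metric, of the restriction of `f` to `S^n`. -/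
def sphereGrad {n : ℕ} (f : RealHyp n → ℝ) (x : RealHyp n) : RealHyp n :=
  gradient f x - (inner ℝ x (gradient f x) : ℝ) • x

/-- The functions used to perturb the double cover: smooth functions on `S^n` (restricted from the
ambient space) whose gradient crosses each great sphere `{x_j = 0}` transversely, in the positive
direction.  These include the functions `∑_j g(x_j)`, where `g` is smooth and odd and `g'` is
strictly decreasing on `[0, ∞)`. -/
def IsPotential {n : ℕ} (f : RealHyp n → ℝ) : Prop :=
  ContDiff ℝ ∞ f ∧ ∀ x : RealHyp n, ‖x‖ = 1 → ∀ j : Fin (n + 2),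
    (x : EuclideanSpace ℝ (Fin (n + 2))) j = 0 →
    0 < (sphereGrad f x : EuclideanSpace ℝ (Fin (n + 2))) j

/-- `σ : S^n → Mbar0` is a continuous lift, along the covering of the pair of pants, of Sheridan's
immersion `i_ε : S^n → ℙ(H)`, the image of the graph of `ε df` under the Weinstein neighbourhood
`W`.  (In particular the graph lies in the disc bundle and `i_ε` has image in the pair of pants.)
The pull-back of the immersion is the union of the images of its continuous lifts. -/
def IsSphereLift {n : ℕ} (W : WeinsteinNbhd n) (f : RealHyp n → ℝ) (ε : ℝ)
    (σ : Sph n → (Fin (n + 2) → ℂ)) : Prop :=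
  Continuous σ ∧ ∀ x : Sph n, σ x ∈ Mbar0 n ∧
    ((x : RealHyp n), ε • sphereGrad f (x : RealHyp n)) ∈ discBundle n W.η ∧
    ∃ hz : W.toFun ((x : RealHyp n), ε • sphereGrad f (x : RealHyp n)) ≠ 0,
      cover (σ x) =
        Projectivization.mk ℂ (W.toFun ((x : RealHyp n), ε • sphereGrad f (x : RealHyp n))) hz

/-- The lift `σ` has argument projection within distance `δ` of the boundary of the zonotope
`Z_{n+2}` centred at the origin.  For small `δ` this singles out the lift whose image is the
sphere `L_{n+2}` among the `n + 2` lifts. -/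
def IsLastSphere {n : ℕ} (W : WeinsteinNbhd n) (f : RealHyp n → ℝ) (ε δ : ℝ)
    (σ : Sph n → (Fin (n + 2) → ℂ)) : Prop :=
  IsSphereLift W f ε σ ∧
    ∀ x, argMap (σ x) ∈ Metric.thickening δ (torusProj '' frontier (zonotope n))

end Pants

end

/-!
A point `u` of `Mbar0` is a choice of homogeneous coordinates, of product `1`, of its image in the
pair of pants (`cover_eq_mk`).  Over the positive part these coordinates are
`ξ (∑ s, -s₁, …, -s_{n+1})` with `s` positive, `(∑ s) (∏ s) = 1` and `ξ ^ (n + 2) = (-1) ^ (n + 1)`.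
So there is one component for each such `ξ`, parametrised by `s` (`isThimble_iff`), and it projects
to the single point `thimblePt n a = (a, a + π, …, a + π)` with `a = arg ξ`.

The zonotope consists of the vectors `φ - mean φ`, without their last coordinate, for
`φ ∈ [0, π] ^ (n + 2)` (`zonotope_eq`); those `φ` with both `0` and `π` among their coordinates give
boundary points (`zonoMap_mem_frontier`).  If `thimblePt n a` lies in its image, then `φ` must be
`(π, 0, …, 0)` or `(0, π, …, π)`, which gives `a = ± (n + 1) π / (n + 2)`
(`eq_exceptionalAngle_of_thimblePt_mem`).  The remaining finitely many thimble points have a positive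
distance from the image of the zonotope, and this provides `δ₀`.

For the Lagrangian spheres, let `w` be the homogeneous coordinates of `i_ε (x)`.  The zero section
is real, and the map is symplectic; hence, where `x_j = 0`, the imaginary part of `w_j` grows in `ε`
at the rate of the `j`-th component of the gradient (`WeinsteinNbhd.fderiv_vertical_im`), which is
positive.  By compactness of the sphere, for small `ε` all the `w_j` are non-zero with arguments `φ_j`
nearly in `[0, π]`, and some `φ_i` is nearly `0` and some `φ_k` nearly `π`, because `∑ x_j = 0`
(`eventually_nearlyReal`).  Dividing `w` by the root of `∏ w_j` given by this branch of the
argument is a continuous lift with argument projection `φ - mean φ`, near the boundary of the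
zonotope; in particular it avoids the thimbles whose points are outside.

Any other lift is the product of this one with a constant root of unity `c`.  At the two points of
the sphere with coordinates of signs `(-, +, …, +)` and `(+, -, …, -)` the original lift projects
near the two exceptional thimble points.  If the other lift also stays near the zonotope, then
translation by `arg c` permutes the two exceptional angles, and since `n + 2` does not divide `2`
this forces `c = 1` (`lift_unique`).
-/

noncomputable section

open Set Filter Topology

namespace Pants

/-! ### The zonotope and its image in the torus -/

/-- Subtract the mean from a vector with `n + 2` coordinates, and drop the last coordinate, which
is minus the sum of the others. -/
def zonoMap {n : ℕ} (φ : Fin (n + 2) → ℝ) : Fin (n + 1) → ℝ :=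
  fun i => φ i.castSucc - (∑ k, φ k) / ((n : ℝ) + 2)

lemma continuous_zonoMap {n : ℕ} : Continuous (zonoMap (n := n)) := by
  unfold zonoMap; fun_prop

lemma fVec_apply (n : ℕ) (i j : Fin (n + 1)) :
    fVec n i j = (if i = j then 1 else 0) - 1 / ((n : ℝ) + 2) := by
  simp [fVec, Finset.sum_apply, Pi.single_apply, eq_comm]

lemma zonotope_eq (n : ℕ) :
    zonotope n = zonoMap '' {φ : Fin (n + 2) → ℝ | ∀ j, φ j ∈ Icc 0 Real.pi} := by
  have hn : (n : ℝ) + 2 ≠ 0 := by positivity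
  have key : ∀ (t : Fin (n + 1) → ℝ) (s : ℝ),
      (∑ i, t i • Real.pi • fVec n i) + s • (-∑ i, Real.pi • fVec n i) =
        zonoMap (Fin.snoc (α := fun _ => ℝ) (fun i => Real.pi * t i) (Real.pi * s)) := by
    intro t s
    ext j
    have h1 : ∑ i, t i * (Real.pi * ((if i = j then 1 else 0) - 1 / ((n : ℝ) + 2))) =
        Real.pi * t j - Real.pi * (∑ i, t i) / ((n : ℝ) + 2) := by
      simp only [mul_sub, Finset.sum_sub_distrib, mul_ite, mul_one, mul_zero, Finset.sum_ite_eq',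
        Finset.mem_univ, if_true, ← Finset.sum_mul]
      ring
    have h2 : ∑ i : Fin (n + 1), Real.pi * ((if i = j then 1 else 0) - 1 / ((n : ℝ) + 2)) =
        Real.pi / ((n : ℝ) + 2) := by
      simp only [← Finset.mul_sum, Finset.sum_sub_distrib, Finset.sum_ite_eq', Finset.mem_univ,
        if_true, Finset.sum_const, Finset.card_univ, Fintype.card_fin, nsmul_eq_mul]
      push_cast
      field_simp
      ring
    have h3 : ∑ k, Fin.snoc (α := fun _ => ℝ) (fun i => Real.pi * t i) (Real.pi * s) k =
        Real.pi * ∑ i, t i + Real.pi * s := by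
      rw [Fin.sum_univ_castSucc]
      simp [Finset.mul_sum]
    simp only [Pi.add_apply, Finset.sum_apply, Pi.smul_apply, Pi.neg_apply, fVec_apply,
      smul_eq_mul, zonoMap, Fin.snoc_castSucc, h1, h2, h3]
    ring
  ext θ
  simp only [zonotope, Set.mem_add, Set.mem_finsetSum, segment_eq_image, smul_zero, zero_add]
  constructor
  · rintro ⟨a, ⟨g, hg, rfl⟩, b, ⟨s, hs, rfl⟩, rfl⟩
    have hg' : ∀ i, ∃ t ∈ Icc (0 : ℝ) 1, t • Real.pi • fVec n i = g i := fun i =>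
      hg (Finset.mem_univ i)
    choose t ht htg using hg'
    refine ⟨_, ?_, by simpa only [htg] using (key t s).symm⟩
    intro j
    have hp := Real.pi_pos
    refine Fin.lastCases ?_ (fun i => ?_) j
    · simp only [Fin.snoc_last]
      exact ⟨mul_nonneg hp.le hs.1, mul_le_of_le_one_right hp.le hs.2⟩
    · simp only [Fin.snoc_castSucc]
      exact ⟨mul_nonneg hp.le (ht i).1, mul_le_of_le_one_right hp.le (ht i).2⟩
  · rintro ⟨φ, hφ, rfl⟩
    have hp := Real.pi_pos
    have hm : ∀ j, φ j / Real.pi ∈ Icc (0 : ℝ) 1 := fun j =>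
      ⟨div_nonneg (hφ j).1 hp.le, (div_le_one hp).2 (hφ j).2⟩
    refine ⟨_, ⟨fun i => (φ i.castSucc / Real.pi) • Real.pi • fVec n i,
      fun {i} _ => ⟨_, hm _, rfl⟩, rfl⟩, _, ⟨φ (Fin.last _) / Real.pi, hm _, rfl⟩, ?_⟩
    simp only
    rw [key (fun i => φ i.castSucc / Real.pi)]
    congr 1
    ext j
    refine Fin.lastCases ?_ (fun i => ?_) j <;> simp <;> field_simp

lemma isCompact_zonotope (n : ℕ) : IsCompact (zonotope n) := by
  rw [zonotope_eq]
  refine IsCompact.image ?_ continuous_zonoMap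
  have := isCompact_univ_pi (fun _ : Fin (n + 2) => isCompact_Icc (a := (0 : ℝ)) (b := Real.pi))
  convert this using 1
  ext φ
  simp only [mem_ofPred_eq, Set.mem_pi, mem_univ, true_imp_iff]

/-- The boundary of the zonotope is the part where the spread of the coordinates is maximal. -/
lemma zonoMap_mem_frontier {n : ℕ} {φ : Fin (n + 2) → ℝ} (hφ : ∀ j, φ j ∈ Icc 0 Real.pi)
    {i k : Fin (n + 2)} (hi : φ i = 0) (hk : φ k = Real.pi) :
    zonoMap φ ∈ frontier (zonotope n) := by
  have hn : (n : ℝ) + 2 ≠ 0 := by positivity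
  have hmem : zonoMap φ ∈ zonotope n := by rw [zonotope_eq]; exact ⟨φ, hφ, rfl⟩
  rw [(isCompact_zonotope n).isClosed.frontier_eq]
  refine ⟨hmem, fun hint => ?_⟩
  -- the missing coordinate of a point of the zonotope, as a function of the point
  let full : (Fin (n + 1) → ℝ) → Fin (n + 2) → ℝ := fun θ =>
    Fin.snoc (α := fun _ => ℝ) θ (-∑ i, θ i)
  have hfull : ∀ ψ : Fin (n + 2) → ℝ, ∀ j,
      full (zonoMap ψ) j = ψ j - (∑ k, ψ k) / ((n : ℝ) + 2) := by
    intro ψ j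
    refine Fin.lastCases ?_ (fun i => ?_) j
    · simp only [full, Fin.snoc_last, zonoMap, Finset.sum_sub_distrib, Finset.sum_const,
        Finset.card_univ, Fintype.card_fin, nsmul_eq_mul, Fin.sum_univ_castSucc]
      field_simp
      ring
    · simp [full, zonoMap]
  have hbd : ∀ θ ∈ zonotope n, full θ k - full θ i ≤ Real.pi := by
    intro θ hθ
    rw [zonotope_eq] at hθ
    obtain ⟨ψ, hψ, rfl⟩ := hθ
    rw [hfull, hfull]
    linarith [(hψ k).2, (hψ i).1]
  -- stretching the point away from the origin leaves the zonotope
  have hcont : Tendsto (fun s : ℝ => zonoMap ((1 + s) • φ)) (𝓝[>] 0) (𝓝 (zonoMap φ)) := by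
    have : Continuous (fun s : ℝ => zonoMap ((1 + s) • φ)) :=
      continuous_zonoMap.comp (by fun_prop)
    simpa using (this.tendsto 0).mono_left nhdsWithin_le_nhds
  have hev := hcont.eventually (mem_interior_iff_mem_nhds.1 hint)
  obtain ⟨s, hs, hs0⟩ := (hev.and self_mem_nhdsWithin).exists
  have h := hbd _ hs
  rw [hfull, hfull] at h
  have hs0 : 0 < s := hs0
  simp only [Pi.smul_apply, smul_eq_mul, hi, hk] at h
  nlinarith [Real.pi_pos]

lemma continuous_torusProj {n : ℕ} : Continuous (torusProj (n := n)) :=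
  continuous_pi fun i => Real.Angle.continuous_coe.comp (continuous_apply i)

lemma isCompact_torusProj_zonotope (n : ℕ) : IsCompact (torusProj '' zonotope n) :=
  (isCompact_zonotope n).image continuous_torusProj

lemma torusProj_frontier_subset (n : ℕ) :
    torusProj '' frontier (zonotope n) ⊆ torusProj '' zonotope n :=
  image_mono (isCompact_zonotope n).isClosed.frontier_subset

lemma dist_coe_angle_le (a b : ℝ) : dist (a : Real.Angle) (b : Real.Angle) ≤ |a - b| := by
  rw [dist_eq_norm, ← Real.Angle.coe_sub]
  exact QuotientAddGroup.norm_mk_le_norm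

lemma dist_torusProj_zonoMap_le {n : ℕ} {φ ψ : Fin (n + 2) → ℝ} {d : ℝ}
    (h : ∀ j, |φ j - ψ j| ≤ d) :
    dist (torusProj (zonoMap φ)) (torusProj (zonoMap ψ)) ≤ 2 * d := by
  have hd : 0 ≤ d := (abs_nonneg _).trans (h 0)
  refine (dist_pi_le_iff (by positivity)).2 fun i => (dist_coe_angle_le _ _).trans ?_
  have hn : (0 : ℝ) < (n : ℝ) + 2 := by positivity
  have h1 : |(∑ k, φ k) / ((n : ℝ) + 2) - (∑ k, ψ k) / ((n : ℝ) + 2)| ≤ d := by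
    rw [← sub_div, ← Finset.sum_sub_distrib, abs_div, abs_of_pos hn, div_le_iff₀ hn]
    calc _ ≤ ∑ k, |φ k - ψ k| := Finset.abs_sum_le_sum_abs _ _
      _ ≤ ∑ k : Fin (n + 2), d := Finset.sum_le_sum fun k _ => h k
      _ = d * (n + 2) := by simp; ring
  have h2 := h i.castSucc
  rw [abs_le] at *
  unfold zonoMap
  constructor <;> linarith [h1.1, h1.2, h2.1, h2.2]

/-- The point `(a, a + π, …, a + π)` of the torus. -/
def thimblePt (n : ℕ) (a : Real.Angle) : Fin (n + 1) → Real.Angle :=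
  fun i => if i = 0 then a else a + (Real.pi : ℝ)

/-- The angle `(n + 1) π / (n + 2)`. -/
def exceptionalAngle (n : ℕ) : Real.Angle :=
  ((((n : ℝ) + 1) / ((n : ℝ) + 2) * Real.pi : ℝ) : Real.Angle)

lemma nsmul_exceptionalAngle (n : ℕ) :
    (n + 2) • exceptionalAngle n = (n + 1) • ((Real.pi : ℝ) : Real.Angle) := by
  rw [exceptionalAngle, ← Real.Angle.coe_nsmul, ← Real.Angle.coe_nsmul]
  congr 1
  simp only [nsmul_eq_mul]
  push_cast
  field_simp

/-- Two numbers in `[0, π]` that differ by `π` modulo `2 π` are the ends of the interval. -/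
lemma eq_zero_or_eq_pi_of_coe_eq_add_pi {x y : ℝ} (hx : x ∈ Icc 0 Real.pi)
    (hy : y ∈ Icc 0 Real.pi) (h : (y : Real.Angle) = x + (Real.pi : ℝ)) :
    (x = 0 ∧ y = Real.pi) ∨ (x = Real.pi ∧ y = 0) := by
  rw [← Real.Angle.coe_add, Real.Angle.angle_eq_iff_two_pi_dvd_sub] at h
  obtain ⟨k, hk⟩ := h
  have hp := Real.pi_pos
  obtain ⟨hx0, hx1⟩ := hx
  obtain ⟨hy0, hy1⟩ := hy
  have h1 : k ≤ 0 := by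
    by_contra hc
    have : (1 : ℝ) ≤ k := by exact_mod_cast not_le.1 hc
    nlinarith
  have h2 : -1 ≤ k := by
    by_contra hc
    have : (k : ℝ) ≤ -2 := by exact_mod_cast (by omega : k ≤ -2)
    nlinarith
  interval_cases k
  · right; push_cast at hk; constructor <;> linarith
  · left; push_cast at hk; constructor <;> linarith

/-- The exceptional thimble points are the only ones in the zonotope: all the coordinates but the
first must lie opposite to it, also the last one, which the torus does not record. -/
lemma eq_exceptionalAngle_of_thimblePt_mem {n : ℕ} {a : Real.Angle}
    (ha : (n + 2) • a = (n + 1) • ((Real.pi : ℝ) : Real.Angle))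
    (h : thimblePt n a ∈ torusProj '' zonotope n) :
    a = exceptionalAngle n ∨ a = -exceptionalAngle n := by
  rw [zonotope_eq] at h
  obtain ⟨_, ⟨φ, hφ, rfl⟩, hθ⟩ := h
  have hn : (n : ℝ) + 2 ≠ 0 := by positivity
  set m : ℝ := (∑ k, φ k) / ((n : ℝ) + 2) with hm
  have hc : ∀ i : Fin (n + 1), ((φ i.castSucc - m : ℝ) : Real.Angle) = thimblePt n a i :=
    fun i => congrFun hθ i
  have h0 : ((φ 0 - m : ℝ) : Real.Angle) = a := by simpa [thimblePt] using hc 0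
  have hmid : ∀ i : Fin n, ((φ i.succ.castSucc - m : ℝ) : Real.Angle) = a + (Real.pi : ℝ) := by
    intro i; rw [hc]; simp [thimblePt]
  have hsum : ∑ j, (φ j - m) = 0 := by
    rw [Finset.sum_sub_distrib, hm]; simp; field_simp; ring
  have hlast : ((φ (Fin.last _) - m : ℝ) : Real.Angle) = a + (Real.pi : ℝ) := by
    have h1 : ((∑ j, (φ j - m) : ℝ) : Real.Angle) = 0 := by rw [hsum]; simp
    rw [Fin.sum_univ_castSucc, Fin.sum_univ_succ, Real.Angle.coe_add, Real.Angle.coe_add] at h1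
    have h2 : ((∑ i : Fin n, (φ i.succ.castSucc - m) : ℝ) : Real.Angle) =
        n • (a + ((Real.pi : ℝ) : Real.Angle)) := by
      rw [← Real.Angle.coe_coeHom, map_sum]
      simp only [Real.Angle.coe_coeHom, hmid]
      simp
    rw [h2, Fin.castSucc_zero, h0] at h1
    have h3 : (2 : ℕ) • ((Real.pi : ℝ) : Real.Angle) = 0 := Real.Angle.two_nsmul_coe_pi
    rw [eq_neg_of_add_eq_zero_right h1]
    have : a + ((Real.pi : ℝ) : Real.Angle) + (a + n • (a + ((Real.pi : ℝ) : Real.Angle))) = 0 := by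
      have : a + ((Real.pi : ℝ) : Real.Angle) + (a + n • (a + ((Real.pi : ℝ) : Real.Angle))) =
        (n + 2) • a + (n + 1) • ((Real.pi : ℝ) : Real.Angle) := by
          simp only [smul_add, add_smul, one_smul, two_smul]; abel
      rw [this, ha, ← two_nsmul, smul_comm, h3, smul_zero]
    exact (eq_neg_of_add_eq_zero_left this).symm
  have hall : ∀ j : Fin (n + 1), (φ j.succ : Real.Angle) = φ 0 + (Real.pi : ℝ) := by
    intro j
    have : ((φ j.succ - m : ℝ) : Real.Angle) = a + (Real.pi : ℝ) := by
      refine Fin.lastCases ?_ (fun i => ?_) j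
      · exact hlast
      · rw [Fin.succ_castSucc]; exact hmid i
    rw [← h0, ← Real.Angle.coe_add] at this
    rw [show φ j.succ = (φ j.succ - m) + m by ring, Real.Angle.coe_add, this, ← Real.Angle.coe_add,
      ← Real.Angle.coe_add]
    congr 1; ring
  have hcases := fun j => eq_zero_or_eq_pi_of_coe_eq_add_pi (hφ 0) (hφ (Fin.succ j)) (hall j)
  have hp := Real.pi_pos
  rw [← h0, hm, Fin.sum_univ_succ]
  rcases hcases 0 with h | h
  · have : ∀ j : Fin (n + 1), φ j.succ = Real.pi := fun j => by
      rcases hcases j with h' | h'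
      · exact h'.2
      · linarith [h.1, h'.1]
    right
    simp only [this, h.1, exceptionalAngle]
    rw [← Real.Angle.coe_neg]
    congr 1
    simp; field_simp
  · have : ∀ j : Fin (n + 1), φ j.succ = 0 := fun j => by
      rcases hcases j with h' | h'
      · linarith [h.1, h'.1]
      · exact h'.2
    left
    simp only [this, h.1, exceptionalAngle]
    congr 1
    simp; field_simp; ring

/-- The thimble points outside the zonotope have a definite distance from it. -/
lemma exists_thickening_disjoint (n : ℕ) : ∃ δ₀ : ℝ, 0 < δ₀ ∧
    Disjoint (Metric.thickening δ₀ (thimblePt n '' {a | (n + 2) • a = (n + 1) •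
      ((Real.pi : ℝ) : Real.Angle) ∧ a ≠ exceptionalAngle n ∧ a ≠ -exceptionalAngle n}))
      (Metric.thickening δ₀ (torusProj '' zonotope n)) := by
  refine Disjoint.exists_thickenings ?_ ?_ (isCompact_torusProj_zonotope n).isClosed
  · rw [Set.disjoint_left]
    rintro _ ⟨a, ⟨ha, h1, h2⟩, rfl⟩ h
    exact (eq_exceptionalAngle_of_thimblePt_mem ha h).elim h1 h2
  · refine (Set.Finite.image _ ?_).isCompact
    have hfin : {a : Real.Angle | (n + 2) • a = 0}.Finite :=
      AddCircle.finite_torsion (2 * Real.pi) (by omega : 0 < n + 2)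
    refine (hfin.preimage (f := fun a => a - exceptionalAngle n)
      (sub_left_injective.injOn)).subset ?_
    rintro a ⟨ha, -, -⟩
    simp only [mem_preimage, mem_ofPred_eq, smul_sub, ha, nsmul_exceptionalAngle, sub_self]

/-! ### The thimbles -/

lemma ne_zero_of_mem_Mbar0 {n : ℕ} {u : Fin (n + 2) → ℂ} (hu : u ∈ Mbar0 n) (i : Fin (n + 2)) :
    u i ≠ 0 := by
  intro h
  have := hu.1
  rw [Finset.prod_eq_zero (Finset.mem_univ i) h] at this
  exact zero_ne_one this

lemma cover_eq_mk {n : ℕ} {u : Fin (n + 2) → ℂ} (hu : u ∈ Mbar0 n) :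
    ∃ h : u ≠ 0, cover u = Projectivization.mk ℂ u h := by
  have h : u ≠ 0 := fun h => ne_zero_of_mem_Mbar0 hu 0 (by rw [h]; rfl)
  refine ⟨h, (Projectivization.mk_eq_mk_iff' ℂ _ _ _ _).2 ⟨∏ j : Fin (n + 1), u j.castSucc, ?_⟩⟩
  ext j
  refine Fin.lastCases ?_ (fun i => ?_) j
  · have := hu.1
    rw [Fin.prod_univ_castSucc] at this
    simpa [coverVec] using this
  · simp [coverVec, mul_comm]

/-- The point `ξ · (s₁ + ⋯ + s_{n+1}, -s₁, …, -s_{n+1})`. -/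
def thimbleMap {n : ℕ} (ξ : ℂ) (s : Fin (n + 1) → ℝ) : Fin (n + 2) → ℂ :=
  Fin.cons (α := fun _ => ℂ) (ξ * ∑ i, (s i : ℂ)) fun i => -ξ * s i

/-- The domain of the parametrisation of the thimbles. -/
def thimbleDomain (n : ℕ) : Set (Fin (n + 1) → ℝ) :=
  {s | (∀ i, 0 < s i) ∧ (∑ i, s i) * ∏ i, s i = 1}

/-- The thimble in the direction `ξ`; here `ξ` is a root of `ξ ^ (n + 2) = (-1) ^ (n + 1)`. -/
def thimble (n : ℕ) (ξ : ℂ) : Set (Fin (n + 2) → ℂ) :=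
  thimbleMap ξ '' thimbleDomain n

lemma prod_thimbleMap {n : ℕ} (ξ : ℂ) (s : Fin (n + 1) → ℝ) :
    ∏ i, thimbleMap ξ s i =
      ξ ^ (n + 2) * (-1) ^ (n + 1) * (((∑ i, s i) * ∏ i, s i : ℝ) : ℂ) := by
  simp only [thimbleMap, Fin.prod_univ_succ (n := n + 1), Fin.cons_zero, Fin.cons_succ,
    Finset.prod_mul_distrib, Finset.prod_const, Finset.card_univ, Fintype.card_fin]
  push_cast
  rw [neg_pow ξ]
  ring

lemma norm_eq_one_of_pow {n : ℕ} {ξ : ℂ} (hξ : ξ ^ (n + 2) = (-1) ^ (n + 1)) : ‖ξ‖ = 1 := by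
  have := congrArg norm hξ
  rw [norm_pow, norm_pow, norm_neg, norm_one, one_pow] at this
  exact (pow_eq_one_iff_of_nonneg (norm_nonneg _) (by omega)).1 this

lemma thimble_subset_positivePreimage {n : ℕ} {ξ : ℂ} (hξ : ξ ^ (n + 2) = (-1) ^ (n + 1)) :
    thimble n ξ ⊆ positivePreimage n := by
  rintro _ ⟨s, ⟨hs, hs1⟩, rfl⟩
  have hM : thimbleMap ξ s ∈ Mbar0 n := by
    refine ⟨?_, ?_⟩
    · rw [prod_thimbleMap, hs1, hξ, ← mul_pow]; simp
    · rw [Fin.sum_univ_succ]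
      simp [thimbleMap, ← Finset.mul_sum]
  obtain ⟨h0, hc⟩ := cover_eq_mk hM
  refine ⟨hM, ⟨_, h0, hc, hM.2, ne_zero_of_mem_Mbar0 hM⟩,
    (thimbleMap ξ s (Fin.last _))⁻¹ • thimbleMap ξ s, ?_, ?_, ?_, ?_⟩
  · exact smul_ne_zero (inv_ne_zero (ne_zero_of_mem_Mbar0 hM _)) h0
  · rw [hc]
    refine (Projectivization.mk_eq_mk_iff' ℂ _ _ _ _).2 ⟨thimbleMap ξ s (Fin.last _), ?_⟩
    rw [smul_inv_smul₀ (ne_zero_of_mem_Mbar0 hM _)]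
  · simp [ne_zero_of_mem_Mbar0 hM _]
  · intro i hi
    obtain ⟨j, rfl⟩ := Fin.exists_succ_eq.2 hi
    refine ⟨s j / s (Fin.last _), div_pos (hs _) (hs _), ?_⟩
    have hξ0 : ξ ≠ 0 := by
      rintro rfl
      simpa using norm_eq_one_of_pow hξ
    have hsl : (s (Fin.last n) : ℂ) ≠ 0 := by exact_mod_cast (hs _).ne'
    rw [Pi.smul_apply, ← Fin.succ_last]
    simp only [thimbleMap, Fin.cons_succ, smul_eq_mul]
    push_cast
    field_simp

lemma exists_mem_thimble {n : ℕ} {u : Fin (n + 2) → ℂ} (hu : u ∈ positivePreimage n) :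
    ∃ ξ : ℂ, ξ ^ (n + 2) = (-1) ^ (n + 1) ∧ u ∈ thimble n ξ := by
  obtain ⟨hM, -, z, hz, hzc, hz1, hzp⟩ := hu
  obtain ⟨h0, hc⟩ := cover_eq_mk hM
  obtain ⟨a, ha⟩ := (Projectivization.mk_eq_mk_iff' ℂ _ _ _ _).1 (hc.symm.trans hzc)
  have ha0 : a ≠ 0 := by
    rintro rfl
    exact h0 (by rw [← ha, zero_smul])
  choose r hr hzr using fun i : Fin (n + 1) => hzp i.succ (Fin.succ_ne_zero i)
  have hna : (‖a‖ : ℂ) ≠ 0 := by simpa using ha0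
  have hs : ∀ i, u (Fin.succ i) = -(-a / ‖a‖) * ((‖a‖ * r i : ℝ) : ℂ) := by
    intro i
    rw [← ha, Pi.smul_apply, hzr, smul_eq_mul]
    push_cast
    field_simp
  have hu' : u = thimbleMap (-a / ‖a‖) fun i => ‖a‖ * r i := by
    ext j
    refine Fin.cases ?_ (fun i => ?_) j
    · have := hM.2
      rw [Fin.sum_univ_succ] at this
      rw [eq_neg_of_add_eq_zero_left this]
      simp only [hs, thimbleMap, Fin.cons_zero, Finset.mul_sum, ← Finset.sum_neg_distrib]
      exact Finset.sum_congr rfl fun i _ => by ring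
    · rw [hs]; rfl
  have hpos : ∀ i, 0 < ‖a‖ * r i := fun i => mul_pos (norm_pos_iff.2 ha0) (hr i)
  have hξ1 : ‖-a / (‖a‖ : ℂ)‖ = 1 := by
    rw [norm_div, norm_neg, Complex.norm_real, norm_norm, div_self (norm_ne_zero_iff.2 ha0)]
  have hprod := prod_thimbleMap (-a / ‖a‖) fun i => ‖a‖ * r i
  rw [← hu', hM.1] at hprod
  have hone : (∑ i, ‖a‖ * r i) * ∏ i, (‖a‖ * r i) = 1 := by
    have := congrArg norm hprod
    rw [norm_mul, norm_mul, norm_pow, norm_pow, hξ1, norm_neg, norm_one, one_pow, one_pow,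
      one_mul, one_mul, Complex.norm_real, Real.norm_of_nonneg] at this
    · exact this.symm
    · exact mul_nonneg (Finset.sum_nonneg fun i _ => (hpos i).le)
        (Finset.prod_nonneg fun i _ => (hpos i).le)
  refine ⟨-a / ‖a‖, ?_, _, ⟨hpos, hone⟩, hu'.symm⟩
  rw [hone, Complex.ofReal_one, mul_one] at hprod
  have h1 : ((-1 : ℂ) ^ (n + 1)) * (-1) ^ (n + 1) = 1 := by rw [← mul_pow]; simp
  calc (-a / (‖a‖ : ℂ)) ^ (n + 2)
      = (-a / (‖a‖ : ℂ)) ^ (n + 2) * (-1) ^ (n + 1) * (-1) ^ (n + 1) := by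
        rw [mul_assoc, h1, mul_one]
    _ = (-1) ^ (n + 1) := by rw [← hprod, one_mul]

lemma isPreconnected_thimbleDomain (n : ℕ) : IsPreconnected (thimbleDomain n) := by
  -- rescaling maps the positive orthant onto the domain
  have hconv : Convex ℝ {s : Fin (n + 1) → ℝ | ∀ i, 0 < s i} := by
    have : {s : Fin (n + 1) → ℝ | ∀ i, 0 < s i} = univ.pi fun _ => Ioi 0 := by ext; simp
    rw [this]
    exact convex_pi fun _ _ => convex_Ioi 0
  have hP : ∀ s : Fin (n + 1) → ℝ, (∀ i, 0 < s i) → 0 < (∑ i, s i) * ∏ i, s i := fun s hs =>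
    mul_pos (Finset.sum_pos (fun i _ => hs i) Finset.univ_nonempty)
      (Finset.prod_pos fun i _ => hs i)
  let F : (Fin (n + 1) → ℝ) → (Fin (n + 1) → ℝ) := fun s =>
    (((∑ i, s i) * ∏ i, s i) ^ (-(1 / ((n : ℝ) + 2)))) • s
  have himg : thimbleDomain n = F '' {s | ∀ i, 0 < s i} := by
    ext s
    constructor
    · rintro ⟨hs, h1⟩
      exact ⟨s, hs, by simp only [F, h1, Real.one_rpow, one_smul]⟩
    · rintro ⟨s, hs, rfl⟩
      have hpow := Real.rpow_pos_of_pos (hP s hs) (-(1 / ((n : ℝ) + 2)))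
      refine ⟨fun i => mul_pos hpow (hs i), ?_⟩
      simp only [F, Pi.smul_apply, smul_eq_mul, ← Finset.mul_sum, Finset.prod_mul_distrib,
        Finset.prod_const, Finset.card_univ, Fintype.card_fin]
      set P := (∑ i, s i) * ∏ i, s i with hPdef
      have h2 : (P ^ (-(1 / ((n : ℝ) + 2)))) ^ (n + 2) = P⁻¹ := by
        rw [← Real.rpow_natCast, ← Real.rpow_mul (hP s hs).le, ← Real.rpow_neg_one]
        congr 1
        push_cast
        field_simp
      calc _ = (P ^ (-(1 / ((n : ℝ) + 2)))) ^ (n + 2) * P := by rw [hPdef]; ring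
        _ = 1 := by rw [h2, inv_mul_cancel₀ (hP s hs).ne']
  rw [himg]
  refine hconv.isPreconnected.image F ?_
  refine ContinuousOn.smul (ContinuousOn.rpow_const (by fun_prop) fun s hs => ?_) continuousOn_id
  exact Or.inl (hP s hs).ne'

lemma isPreconnected_thimble (n : ℕ) (ξ : ℂ) : IsPreconnected (thimble n ξ) := by
  refine (isPreconnected_thimbleDomain n).image _ (Continuous.continuousOn ?_)
  refine continuous_pi fun j => ?_
  refine Fin.cases ?_ (fun i => ?_) j <;> simp only [thimbleMap, Fin.cons_zero, Fin.cons_succ] <;>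
    fun_prop

/-- On a thimble, the direction of the first coordinate is constant. -/
lemma thimble_dir {n : ℕ} {ξ : ℂ} (hξ : ξ ^ (n + 2) = (-1) ^ (n + 1)) {u : Fin (n + 2) → ℂ}
    (hu : u ∈ thimble n ξ) : u 0 / ‖u 0‖ = ξ := by
  obtain ⟨s, ⟨hs, -⟩, rfl⟩ := hu
  have hpos : 0 < ∑ i, s i := Finset.sum_pos (fun i _ => hs i) Finset.univ_nonempty
  have : thimbleMap ξ s 0 = ξ * ((∑ i, s i : ℝ) : ℂ) := by simp [thimbleMap]
  rw [this, norm_mul, norm_eq_one_of_pow hξ, one_mul, Complex.norm_real,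
    Real.norm_of_nonneg hpos.le, mul_div_cancel_right₀]
  exact_mod_cast hpos.ne'

lemma finite_pow_eq (N : ℕ) (hN : 0 < N) (c : ℂ) : {ξ : ℂ | ξ ^ N = c}.Finite := by
  have : {ξ : ℂ | ξ ^ N = c} = ((Polynomial.nthRoots N c).toFinset : Set ℂ) := by
    ext; simp [Polynomial.mem_nthRoots hN]
  rw [this]
  exact Finset.finite_toSet _

lemma connectedComponentIn_positivePreimage {n : ℕ} {ξ : ℂ} (hξ : ξ ^ (n + 2) = (-1) ^ (n + 1))
    {u : Fin (n + 2) → ℂ} (hu : u ∈ thimble n ξ) :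
    connectedComponentIn (positivePreimage n) u = thimble n ξ := by
  have hsub := thimble_subset_positivePreimage hξ
  refine Subset.antisymm (fun v hv => ?_)
    ((isPreconnected_thimble n ξ).subset_connectedComponentIn hu hsub)
  have hmaps : MapsTo (fun v : Fin (n + 2) → ℂ => v 0 / (‖v 0‖ : ℂ))
      (connectedComponentIn (positivePreimage n) u) {ξ : ℂ | ξ ^ (n + 2) = (-1) ^ (n + 1)} := by
    intro w hw
    obtain ⟨ξ', hξ', hw'⟩ := exists_mem_thimble (connectedComponentIn_subset _ _ hw)
    simp only [thimble_dir hξ' hw']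
    exact hξ'
  have hcont : ContinuousOn (fun v : Fin (n + 2) → ℂ => v 0 / (‖v 0‖ : ℂ))
      (connectedComponentIn (positivePreimage n) u) := by
    refine ContinuousOn.div (by fun_prop) (by fun_prop) fun w hw => ?_
    have := ne_zero_of_mem_Mbar0 (connectedComponentIn_subset _ _ hw).1 0
    simpa using this
  obtain ⟨ξ', hξ', hv'⟩ := exists_mem_thimble (connectedComponentIn_subset _ _ hv)
  have := isPreconnected_connectedComponentIn.constant_of_mapsTo
    (finite_pow_eq (n + 2) (by omega) _).isDiscrete hcont hmaps hv
    (mem_connectedComponentIn (hsub hu))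
  simp only [thimble_dir hξ' hv', thimble_dir hξ hu] at this
  rwa [← this]

lemma argMap_of_mem_thimble {n : ℕ} {ξ : ℂ} (hξ : ξ ^ (n + 2) = (-1) ^ (n + 1))
    {u : Fin (n + 2) → ℂ} (hu : u ∈ thimble n ξ) : argMap u = thimblePt n ξ.arg := by
  have hξ0 : ξ ≠ 0 := by
    rintro rfl
    simpa using norm_eq_one_of_pow hξ
  obtain ⟨s, ⟨hs, -⟩, rfl⟩ := hu
  have hpos : 0 < ∑ i, s i := Finset.sum_pos (fun i _ => hs i) Finset.univ_nonempty
  ext i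
  refine Fin.cases ?_ (fun j => ?_) i
  · have : thimbleMap ξ s 0 = ξ * ((∑ i, s i : ℝ) : ℂ) := by simp [thimbleMap]
    simp only [argMap, thimblePt, Fin.castSucc_zero, if_true, this, Complex.arg_mul_real hpos]
  · have : thimbleMap ξ s j.succ.castSucc = -ξ * (s j.castSucc : ℂ) := by
      rw [← Fin.succ_castSucc]; simp [thimbleMap]
    simp only [argMap, thimblePt, this, Complex.arg_mul_real (hs _), Fin.succ_ne_zero, if_false]
    rw [Complex.arg_neg_coe_angle hξ0]

lemma norm_pow_of_pow_eq {n : ℕ} {ζ : ℂ}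
    (hζ : ζ ^ (n + 2) = (-1) ^ (n + 1) * ((n : ℂ) + 1) ^ (n + 1)) :
    ‖ζ‖ ^ (n + 2) = ((n : ℝ) + 1) ^ (n + 1) := by
  have := congrArg norm hζ
  rw [norm_mul, norm_pow, norm_pow, norm_pow, norm_neg, norm_one, one_pow, one_mul] at this
  rw [this, ← Nat.cast_succ, Complex.norm_natCast, Nat.cast_succ]

lemma norm_pos_of_pow_eq {n : ℕ} {ζ : ℂ}
    (hζ : ζ ^ (n + 2) = (-1) ^ (n + 1) * ((n : ℂ) + 1) ^ (n + 1)) : 0 < ‖ζ‖ := by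
  refine (norm_nonneg ζ).lt_of_ne fun h => ?_
  have h1 := norm_pow_of_pow_eq hζ
  rw [← h, zero_pow (by omega)] at h1
  have : (0 : ℝ) < ((n : ℝ) + 1) ^ (n + 1) := by positivity
  exact this.ne h1

lemma dir_pow_of_pow_eq {n : ℕ} {ζ : ℂ}
    (hζ : ζ ^ (n + 2) = (-1) ^ (n + 1) * ((n : ℂ) + 1) ^ (n + 1)) :
    (ζ / ‖ζ‖) ^ (n + 2) = (-1) ^ (n + 1) := by
  have h1 : (‖ζ‖ : ℂ) ^ (n + 2) = ((n : ℂ) + 1) ^ (n + 1) := by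
    exact_mod_cast congrArg (fun x : ℝ => (x : ℂ)) (norm_pow_of_pow_eq hζ)
  have h2 : ((n : ℂ) + 1) ^ (n + 1) ≠ 0 := pow_ne_zero _ (by exact_mod_cast Nat.succ_ne_zero n)
  rw [div_pow, hζ, h1, mul_div_cancel_right₀ _ h2]

/-- The value `ζ` of the first coordinate is attained where all the `s_i` are equal. -/
lemma exists_mem_thimble_zero_eq {n : ℕ} {ζ : ℂ}
    (hζ : ζ ^ (n + 2) = (-1) ^ (n + 1) * ((n : ℂ) + 1) ^ (n + 1)) :
    ∃ u ∈ thimble n (ζ / ‖ζ‖), u 0 = ζ := by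
  have hpos := norm_pos_of_pow_eq hζ
  have hsum : ∑ _i : Fin (n + 1), ‖ζ‖ / ((n : ℝ) + 1) = ‖ζ‖ := by
    simp; field_simp
  refine ⟨_, ⟨fun _ => ‖ζ‖ / ((n : ℝ) + 1), ⟨fun _ => by positivity, ?_⟩, rfl⟩, ?_⟩
  · simp only [hsum, Finset.prod_const, Finset.card_univ, Fintype.card_fin]
    rw [div_pow, ← mul_div_assoc, ← pow_succ', norm_pow_of_pow_eq hζ, div_self (by positivity)]
  · simp only [thimbleMap, Fin.cons_zero]
    rw [← Complex.ofReal_sum, hsum]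
    have : (‖ζ‖ : ℂ) ≠ 0 := by exact_mod_cast hpos.ne'
    field_simp

lemma isThimble_iff {n : ℕ} {ζ : ℂ}
    (hζ : ζ ^ (n + 2) = (-1) ^ (n + 1) * ((n : ℂ) + 1) ^ (n + 1))
    {C : Set (Fin (n + 2) → ℂ)} : IsThimble n ζ C ↔ C = thimble n (ζ / ‖ζ‖) := by
  have hξ := dir_pow_of_pow_eq hζ
  constructor
  · rintro ⟨⟨u, -, rfl⟩, v, hv, hv0⟩
    obtain ⟨ξ', hξ', hv'⟩ := exists_mem_thimble (connectedComponentIn_subset _ _ hv)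
    have := thimble_dir hξ' hv'
    rw [hv0] at this
    rw [connectedComponentIn_eq hv, connectedComponentIn_positivePreimage hξ' hv', this]
  · rintro rfl
    obtain ⟨u, hu, hu0⟩ := exists_mem_thimble_zero_eq hζ
    exact ⟨⟨u, thimble_subset_positivePreimage hξ hu,
      (connectedComponentIn_positivePreimage hξ hu).symm⟩, u, hu, hu0⟩

lemma argMap_image_thimble {n : ℕ} {ζ : ℂ}
    (hζ : ζ ^ (n + 2) = (-1) ^ (n + 1) * ((n : ℂ) + 1) ^ (n + 1)) :
    argMap '' thimble n (ζ / ‖ζ‖) = {thimblePt n ζ.arg} := by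
  have harg : (ζ / (‖ζ‖ : ℂ)).arg = ζ.arg := by
    rw [div_eq_mul_inv, ← Complex.ofReal_inv,
      Complex.arg_mul_real (inv_pos.2 (norm_pos_of_pow_eq hζ))]
  have h : ∀ u ∈ thimble n (ζ / ‖ζ‖), argMap u = thimblePt n ζ.arg := fun u hu => by
    rw [argMap_of_mem_thimble (dir_pow_of_pow_eq hζ) hu, harg]
  obtain ⟨u, hu, -⟩ := exists_mem_thimble_zero_eq hζ
  exact Subset.antisymm (by rintro _ ⟨v, hv, rfl⟩; exact h v hv)
    (by rintro _ rfl; exact ⟨u, hu, h u hu⟩)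

lemma nsmul_arg_of_pow_eq {n : ℕ} {ζ : ℂ}
    (hζ : ζ ^ (n + 2) = (-1) ^ (n + 1) * ((n : ℂ) + 1) ^ (n + 1)) :
    (n + 2) • (ζ.arg : Real.Angle) = (n + 1) • ((Real.pi : ℝ) : Real.Angle) := by
  have h1 : ((n : ℂ) + 1) ^ (n + 1) = ((((n : ℝ) + 1) ^ (n + 1) : ℝ) : ℂ) := by push_cast; rfl
  rw [← Complex.arg_pow_coe_angle, hζ, h1, Complex.arg_mul_real (by positivity),
    Complex.arg_pow_coe_angle, Complex.arg_neg_one]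

lemma coe_arg_ne_exceptionalAngle {n : ℕ} {ζ : ℂ}
    (h : ζ.arg ≠ ((n : ℝ) + 1) / ((n : ℝ) + 2) * Real.pi) :
    (ζ.arg : Real.Angle) ≠ exceptionalAngle n := by
  intro h'
  apply h
  have hp := Real.pi_pos
  have h0 : 0 ≤ ((n : ℝ) + 1) / ((n : ℝ) + 2) * Real.pi := by positivity
  have h1 : ((n : ℝ) + 1) / ((n : ℝ) + 2) * Real.pi ≤ Real.pi :=
    mul_le_of_le_one_left hp.le ((div_le_one (by positivity)).2 (by linarith))
  have := congrArg Real.Angle.toReal h'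
  rwa [Complex.arg_coe_angle_toReal_eq_arg, exceptionalAngle,
    Real.Angle.toReal_coe_eq_self_iff.2 ⟨by linarith, h1⟩] at this

lemma coe_arg_ne_neg_exceptionalAngle {n : ℕ} {ζ : ℂ}
    (h : ζ.arg ≠ -(((n : ℝ) + 1) / ((n : ℝ) + 2) * Real.pi)) :
    (ζ.arg : Real.Angle) ≠ -exceptionalAngle n := by
  intro h'
  apply h
  have hp := Real.pi_pos
  have h0 : 0 ≤ ((n : ℝ) + 1) / ((n : ℝ) + 2) * Real.pi := by positivity
  have h1 : ((n : ℝ) + 1) / ((n : ℝ) + 2) * Real.pi < Real.pi :=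
    mul_lt_of_lt_one_left hp ((div_lt_one (by positivity)).2 (by linarith))
  have := congrArg Real.Angle.toReal h'
  rwa [Complex.arg_coe_angle_toReal_eq_arg, exceptionalAngle, ← Real.Angle.coe_neg,
    Real.Angle.toReal_coe_eq_self_iff.2 ⟨by linarith, by linarith⟩] at this

/-! ### Lifting through a branch of the logarithm -/

/-- The branch of the logarithm on `ℂ` cut along the negative imaginary axis, with imaginary part
between `-π / 2` and `3 π / 2`. -/
def branchLog (w : ℂ) : ℂ := Complex.log (-Complex.I * w) + Complex.I * ((Real.pi / 2 : ℝ) : ℂ)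

/-- The argument between `-π / 2` and `3 π / 2`. -/
def branchArg (w : ℂ) : ℝ := Complex.arg (-Complex.I * w) + Real.pi / 2

/-- The complex plane cut along the closed negative imaginary axis. -/
def cutPlane : Set ℂ := {w | -Complex.I * w ∈ Complex.slitPlane}

lemma mem_cutPlane {w : ℂ} : w ∈ cutPlane ↔ 0 < w.im ∨ w.re ≠ 0 := by
  simp [cutPlane, Complex.mem_slitPlane_iff]

lemma ne_zero_of_mem_cutPlane {w : ℂ} (hw : w ∈ cutPlane) : w ≠ 0 := by
  rintro rfl
  simp [mem_cutPlane] at hw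

lemma isOpen_cutPlane : IsOpen cutPlane :=
  Complex.isOpen_slitPlane.preimage (by fun_prop)

lemma branchLog_im (w : ℂ) : (branchLog w).im = branchArg w := by
  simp [branchLog, branchArg, Complex.log_im]

lemma exp_branchLog {w : ℂ} (hw : w ≠ 0) : Complex.exp (branchLog w) = w := by
  have h : Complex.exp (Complex.I * ((Real.pi / 2 : ℝ) : ℂ)) = Complex.I := by
    rw [mul_comm]; push_cast; exact Complex.exp_pi_div_two_mul_I
  rw [branchLog, Complex.exp_add, h,
    Complex.exp_log (mul_ne_zero (neg_ne_zero.2 Complex.I_ne_zero) hw)]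
  linear_combination (-w) * Complex.I_mul_I

lemma continuousAt_branchLog {w : ℂ} (hw : w ∈ cutPlane) : ContinuousAt branchLog w :=
  (ContinuousAt.clog (by fun_prop) hw).add continuousAt_const

lemma continuousAt_branchArg {w : ℂ} (hw : w ∈ cutPlane) : ContinuousAt branchArg w :=
  (ContinuousAt.comp (f := fun w => -Complex.I * w) (Complex.continuousAt_arg hw)
    (by fun_prop)).add continuousAt_const

lemma branchArg_ofReal_pos {r : ℝ} (hr : 0 < r) : branchArg r = 0 := by
  rw [branchArg, Complex.arg_mul_real hr, Complex.arg_neg_I]; ring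

lemma branchArg_ofReal_neg {r : ℝ} (hr : r < 0) : branchArg r = Real.pi := by
  have : -Complex.I * (r : ℂ) = Complex.I * ((-r : ℝ) : ℂ) := by push_cast; ring
  rw [branchArg, this, Complex.arg_mul_real (by linarith), Complex.arg_I]; ring

lemma branchArg_mem_of_im_pos {w : ℂ} (hw : 0 < w.im) : branchArg w ∈ Ioo 0 Real.pi := by
  have h : |(-Complex.I * w).arg| < Real.pi / 2 := by
    rw [Complex.abs_arg_lt_pi_div_two_iff]; left; simpa using hw
  rw [abs_lt] at h
  constructor <;> unfold branchArg <;> linarith [h.1, h.2]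

/-- Divide homogeneous coordinates by the `(n + 2)`-nd root of their product that the branch of
the logarithm defines. -/
def liftMap {n : ℕ} (w : Fin (n + 2) → ℂ) : Fin (n + 2) → ℂ :=
  fun j => w j * Complex.exp (-(∑ k, branchLog (w k)) / ((n : ℂ) + 2))

lemma liftMap_mem_Mbar0 {n : ℕ} {w : Fin (n + 2) → ℂ} (hw : ∀ j, w j ≠ 0) (hs : ∑ j, w j = 0) :
    liftMap w ∈ Mbar0 n := by
  constructor
  · have hn : (n : ℂ) + 2 ≠ 0 := by exact_mod_cast (by omega : n + 2 ≠ 0)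
    simp only [liftMap, Finset.prod_mul_distrib, Finset.prod_const, Finset.card_univ,
      Fintype.card_fin]
    rw [← Complex.exp_nat_mul]
    push_cast
    rw [mul_div_cancel₀ _ hn, Complex.exp_neg, Complex.exp_sum]
    simp only [exp_branchLog (hw _)]
    exact mul_inv_cancel₀ (Finset.prod_ne_zero_iff.2 fun j _ => hw j)
  · simp only [liftMap, ← Finset.sum_mul, hs, zero_mul]

lemma cover_liftMap {n : ℕ} {w : Fin (n + 2) → ℂ} (hw : ∀ j, w j ≠ 0) (hs : ∑ j, w j = 0)
    (hw0 : w ≠ 0) : cover (liftMap w) = Projectivization.mk ℂ w hw0 := by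
  obtain ⟨h0, hc⟩ := cover_eq_mk (liftMap_mem_Mbar0 hw hs)
  rw [hc]
  refine (Projectivization.mk_eq_mk_iff' ℂ _ _ _ _).2
    ⟨Complex.exp (-(∑ k, branchLog (w k)) / ((n : ℂ) + 2)), ?_⟩
  ext j
  simp [liftMap, mul_comm]

lemma argMap_liftMap {n : ℕ} {w : Fin (n + 2) → ℂ} (hw : ∀ j, w j ≠ 0) :
    argMap (liftMap w) = torusProj (zonoMap fun j => branchArg (w j)) := by
  ext i
  have h1 : liftMap w i.castSucc = Complex.exp (branchLog (w i.castSucc) +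
      -(∑ k, branchLog (w k)) / ((n : ℂ) + 2)) := by
    rw [Complex.exp_add, exp_branchLog (hw _), liftMap]
  have h2 : (branchLog (w i.castSucc) + -(∑ k, branchLog (w k)) / ((n : ℂ) + 2)).im =
      branchArg (w i.castSucc) - (∑ k, branchArg (w k)) / ((n : ℝ) + 2) := by
    have : ((n : ℂ) + 2) = (((n : ℝ) + 2 : ℝ) : ℂ) := by push_cast; rfl
    rw [Complex.add_im, this, Complex.div_ofReal_im, Complex.neg_im, Complex.im_sum]
    simp only [branchLog_im]
    ring
  simp only [argMap, torusProj, zonoMap, h1, ← h2]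
  rw [Complex.arg_exp]
  exact Real.Angle.coe_toIocMod _ _

lemma continuousAt_liftMap {n : ℕ} {w : Fin (n + 2) → ℂ} (hw : ∀ j, w j ∈ cutPlane) :
    ContinuousAt liftMap w := by
  refine continuousAt_pi.2 fun j => (continuous_apply j).continuousAt.mul ?_
  refine Complex.continuous_exp.continuousAt.comp (ContinuousAt.div_const (ContinuousAt.neg ?_) _)
  refine tendsto_finsetSum _ fun k _ => ?_
  exact ContinuousAt.comp (f := fun w : Fin (n + 2) → ℂ => w k) (continuousAt_branchLog (hw k))
    (continuous_apply k).continuousAt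

/-- The coordinates of `w` lie near the closed upper half plane, as measured by their arguments;
one of them is nearly positive, and one of them nearly negative. -/
def NearlyReal {n : ℕ} (δ : ℝ) (w : Fin (n + 2) → ℂ) : Prop :=
  (∀ j, w j ∈ cutPlane ∧ branchArg (w j) ∈ Ioo (-δ) (Real.pi + δ)) ∧
    (∃ i, |branchArg (w i)| < δ) ∧ ∃ k, |branchArg (w k) - Real.pi| < δ

lemma NearlyReal.argMap_liftMap_mem {n : ℕ} {δ : ℝ} (hδ : δ ≤ 1) {w : Fin (n + 2) → ℂ}
    (h : NearlyReal δ w) :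
    argMap (liftMap w) ∈ Metric.thickening (3 * δ) (torusProj '' frontier (zonotope n)) := by
  obtain ⟨hj, ⟨i, hi⟩, k, hk⟩ := h
  have hδ0 : 0 < δ := (abs_nonneg _).trans_lt hi
  have hpi := Real.pi_gt_three
  have hik : i ≠ k := by
    rintro rfl
    rw [abs_lt] at hi hk
    linarith [hi.2, hk.1]
  rw [argMap_liftMap fun j => ne_zero_of_mem_cutPlane (hj j).1]
  -- clamp the arguments to `[0, π]`, and set the `i`-th to `0` and the `k`-th to `π`
  let ψ : Fin (n + 2) → ℝ := fun j =>
    if j = i then 0 else if j = k then Real.pi else max 0 (min (branchArg (w j)) Real.pi)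
  have hψ : ∀ j, ψ j ∈ Icc 0 Real.pi := by
    intro j
    simp only [ψ]
    split_ifs
    · exact ⟨le_rfl, Real.pi_pos.le⟩
    · exact ⟨Real.pi_pos.le, le_rfl⟩
    · exact ⟨le_max_left _ _, max_le Real.pi_pos.le (min_le_right _ _)⟩
  have hd : ∀ j, |branchArg (w j) - ψ j| ≤ δ := by
    intro j
    simp only [ψ]
    split_ifs with h1 h2
    · rw [h1, sub_zero]; exact hi.le
    · rw [h2]; exact hk.le
    · obtain ⟨h3, h4⟩ := (hj j).2
      rw [abs_le]
      rcases max_cases 0 (min (branchArg (w j)) Real.pi) with h5 | h5 <;>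
        rcases min_cases (branchArg (w j)) Real.pi with h6 | h6 <;>
        constructor <;> linarith [h5.1, h5.2, h6.1, h6.2]
  refine Metric.mem_thickening_iff.2 ⟨_, mem_image_of_mem _ (zonoMap_mem_frontier hψ
    (i := i) (k := k) (by simp [ψ]) (by simp [ψ, hik.symm])), ?_⟩
  exact (dist_torusProj_zonoMap_le hd).trans_lt (by linarith)

/-! ### The perturbed double cover -/

lemma inner_realHyp {n : ℕ} (x y : RealHyp n) : inner ℝ x y =
    ∑ i, (x : EuclideanSpace ℝ (Fin (n + 2))) i * (y : EuclideanSpace ℝ (Fin (n + 2))) i := by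
  rw [Submodule.coe_inner, PiLp.inner_apply]
  exact Finset.sum_congr rfl fun i _ => by simp [mul_comm]

-- The scalar multiplication of `RealHyp n` as a submodule agrees with that of its normed space
-- structure only after unfolding, so that the general lemmas do not rewrite.
lemma realHyp_inner_smul_left {n : ℕ} (x y : RealHyp n) (r : ℝ) :
    inner ℝ (r • x) y = r * inner ℝ x y := real_inner_smul_left x y r

lemma realHyp_inner_smul_right {n : ℕ} (x y : RealHyp n) (r : ℝ) :
    inner ℝ x (r • y) = r * inner ℝ x y := real_inner_smul_right x y r

lemma continuous_sphereGrad {n : ℕ} {f : RealHyp n → ℝ} (hf : ContDiff ℝ ∞ f) :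
    Continuous (sphereGrad f) := by
  have h : Continuous (gradient f) :=
    (InnerProductSpace.toDual ℝ (RealHyp n)).symm.continuous.comp
      (hf.continuous_fderiv (by simp))
  unfold sphereGrad
  fun_prop

lemma inner_sphereGrad {n : ℕ} (f : RealHyp n → ℝ) {x : RealHyp n} (hx : ‖x‖ = 1) :
    inner ℝ x (sphereGrad f x) = 0 := by
  rw [sphereGrad, inner_sub_right, realHyp_inner_smul_right, real_inner_self_eq_norm_sq, hx]
  ring

lemma smul_mem_discBundle {n : ℕ} {η : ℝ} {x v : RealHyp n} (hx : ‖x‖ = 1)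
    (hv : inner ℝ x v = 0) {t : ℝ} (ht : ‖t • v‖ < η) : (x, t • v) ∈ discBundle n η :=
  ⟨hx, by rw [realHyp_inner_smul_right, hv, mul_zero], ht⟩

lemma zero_mem_discBundle {n : ℕ} (W : WeinsteinNbhd n) {x : RealHyp n} (hx : ‖x‖ = 1) :
    (x, (0 : RealHyp n)) ∈ discBundle n W.η :=
  ⟨hx, by simp, by simpa using W.η_pos⟩

lemma WeinsteinNbhd.differentiableAt {n : ℕ} (W : WeinsteinNbhd n) {q : RealHyp n × RealHyp n}
    (hq : q ∈ discBundle n W.η) : DifferentiableAt ℝ W.toFun q :=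
  (W.smooth q hq).differentiableAt (by simp)

/-- Along the zero section the map is the inclusion, in horizontal directions. -/
lemma WeinsteinNbhd.fderiv_horizontal {n : ℕ} (W : WeinsteinNbhd n) {x s : RealHyp n}
    (hx : ‖x‖ = 1) (hs : ‖s‖ = 1) (hxs : inner ℝ x s = 0) (i : Fin (n + 2)) :
    fderiv ℝ W.toFun (x, 0) (s, 0) i = (((s : EuclideanSpace ℝ (Fin (n + 2))) i : ℝ) : ℂ) := by
  -- differentiate along the great circle through `x` in the direction `s`
  let γ : ℝ → RealHyp n := fun t => Real.cos t • x + Real.sin t • s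
  have hγ : ∀ t, ‖γ t‖ = 1 := by
    intro t
    have h1 : ‖γ t‖ ^ 2 = 1 := by
      have hsx : inner ℝ s x = 0 := by rw [real_inner_comm]; exact hxs
      rw [← real_inner_self_eq_norm_sq]
      simp only [γ, inner_add_left, inner_add_right, realHyp_inner_smul_left,
        realHyp_inner_smul_right, hxs, hsx]
      rw [real_inner_self_eq_norm_sq, real_inner_self_eq_norm_sq, hx, hs]
      nlinarith [Real.sin_sq_add_cos_sq t]
    exact (pow_eq_one_iff_of_nonneg (norm_nonneg _) two_ne_zero).1 h1
  have hγd : HasDerivAt γ s 0 := by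
    have h := ((Real.hasDerivAt_cos 0).smul_const x).add ((Real.hasDerivAt_sin 0).smul_const s)
    have h0 : -Real.sin 0 • x + Real.cos 0 • s = s := by simp
    rw [← h0]
    exact h
  have hγ0 : γ 0 = x := by simp [γ]
  have h1 : HasDerivAt (fun t => W.toFun (γ t, 0)) (fderiv ℝ W.toFun (x, 0) (s, 0)) 0 := by
    have hd : HasFDerivAt W.toFun (fderiv ℝ W.toFun (x, 0)) (γ 0, (0 : RealHyp n)) := by
      rw [hγ0]
      exact (W.differentiableAt (zero_mem_discBundle W hx)).hasFDerivAt
    exact hd.comp_hasDerivAt (0 : ℝ) (hγd.prodMk (hasDerivAt_const (0 : ℝ) (0 : RealHyp n)))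
  have h2 := hasDerivAt_pi.1 h1 i
  have h3 : HasDerivAt (fun t => (((γ t : EuclideanSpace ℝ (Fin (n + 2))) i : ℝ) : ℂ))
      (((s : EuclideanSpace ℝ (Fin (n + 2))) i : ℝ) : ℂ) 0 := by
    refine HasDerivAt.ofReal_comp ?_
    exact (((EuclideanSpace.proj i).comp (RealHyp n).subtypeL).hasFDerivAt).comp_hasDerivAt
      (0 : ℝ) hγd
  have h4 : (fun t => W.toFun (γ t, 0) i) =
      fun t => (((γ t : EuclideanSpace ℝ (Fin (n + 2))) i : ℝ) : ℂ) :=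
    funext fun t => W.zero_section _ (hγ t) i
  rw [h4] at h2
  exact h2.unique h3

lemma WeinsteinNbhd.hasDerivAt_vertical {n : ℕ} (W : WeinsteinNbhd n) {x v : RealHyp n} {t : ℝ}
    (ht : (x, t • v) ∈ discBundle n W.η) :
    HasDerivAt (fun t : ℝ => W.toFun (x, t • v)) (fderiv ℝ W.toFun (x, t • v) (0, v)) t := by
  have h := (hasDerivAt_const t x).prodMk ((hasDerivAt_id t).smul_const v)
  simp only [one_smul, id] at h
  exact (W.differentiableAt ht).hasFDerivAt.comp_hasDerivAt t h

/-- Because the zero section is mapped to the real locus and the map is symplectic, a vertical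
tangent vector `v` is mapped to a vector with imaginary part `v`, up to a multiple of the base
point, which is invisible in the coordinates that vanish there. -/
lemma WeinsteinNbhd.fderiv_vertical_im {n : ℕ} (W : WeinsteinNbhd n) {x v : RealHyp n}
    (hx : ‖x‖ = 1) (hxv : inner ℝ x v = 0) {j : Fin (n + 2)}
    (hj : (x : EuclideanSpace ℝ (Fin (n + 2))) j = 0) :
    (fderiv ℝ W.toFun (x, 0) (0, v) j).im = (v : EuclideanSpace ℝ (Fin (n + 2))) j := by
  set b := fderiv ℝ W.toFun (x, 0) (0, v) with hb
  have hsum : ∑ i, b i = 0 := by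
    have h1 : HasDerivAt (fun t : ℝ => W.toFun (x, t • v)) b 0 := by
      have := W.hasDerivAt_vertical (x := x) (v := v) (t := 0)
        (by rw [zero_smul]; exact zero_mem_discBundle W hx)
      rwa [zero_smul] at this
    have h2 : HasDerivAt (fun t : ℝ => ∑ i, W.toFun (x, t • v) i) (∑ i, b i) 0 :=
      HasDerivAt.fun_sum fun i _ => hasDerivAt_pi.1 h1 i
    have hev : ∀ᶠ t : ℝ in 𝓝 0, ‖t • v‖ < W.η := by
      have : Continuous fun t : ℝ => ‖t • v‖ := by fun_prop
      exact this.continuousAt.eventually_lt continuousAt_const (by simpa using W.η_pos)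
    have h3 : (fun t : ℝ => ∑ i, W.toFun (x, t • v) i) =ᶠ[𝓝 0] fun _ => 0 :=
      hev.mono fun t ht => W.mem_hyp _ (smul_mem_discBundle hx hxv ht)
    exact (h2.congr_of_eventuallyEq h3.symm).unique (hasDerivAt_const _ _)
  -- the imaginary part, as a vector of the real hyperplane
  let β : RealHyp n := ⟨WithLp.toLp 2 fun i => (b i).im, by
    change ∑ i, (b i).im = 0
    rw [← Complex.im_sum, hsum, Complex.zero_im]⟩
  have hβ : ∀ i, (β : EuclideanSpace ℝ (Fin (n + 2))) i = (b i).im := fun i => rfl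
  have horth : ∀ s : RealHyp n, ‖s‖ = 1 → inner ℝ x s = 0 → inner ℝ s (β - v) = 0 := by
    intro s hs hxs
    have h := W.symplectic (x, 0) (zero_mem_discBundle W hx) (s, 0) (0, v) hxs (by simp) (by simp)
      (by simpa using hxv)
    have hz : ∀ i, W.toFun (x, 0) i = (((x : EuclideanSpace ℝ (Fin (n + 2))) i : ℝ) : ℂ) :=
      W.zero_section x hx
    have ha := W.fderiv_horizontal hx hs hxs
    have h1 : herm (W.toFun (x, 0)) (W.toFun (x, 0)) = 1 := by
      have : inner ℝ x x = 1 := by rw [real_inner_self_eq_norm_sq, hx]; norm_num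
      rw [inner_realHyp] at this
      simp only [herm, hz, Complex.conj_ofReal]
      exact_mod_cast congrArg (fun r : ℝ => (r : ℂ)) this
    have h2 : herm (fderiv ℝ W.toFun (x, 0) (s, 0)) (W.toFun (x, 0)) = 0 := by
      have : inner ℝ s x = 0 := by rw [real_inner_comm]; exact hxs
      rw [inner_realHyp] at this
      simp only [herm, hz, ha, Complex.conj_ofReal]
      exact_mod_cast congrArg (fun r : ℝ => (r : ℂ)) this
    have h3 : (herm (fderiv ℝ W.toFun (x, 0) (s, 0)) b).im = inner ℝ s β := by
      rw [inner_realHyp]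
      simp only [herm, ha, Complex.conj_ofReal, Complex.im_sum, Complex.im_ofReal_mul, hβ]
    rw [fubiniStudy, ← hb, h1, h2] at h
    simp only [mul_one, zero_mul, sub_zero, Complex.one_re, one_pow, div_one, inner_zero_left,
      h3] at h
    rw [inner_sub_right, h, sub_self]
  set d := β - v with hd
  have hd0 : d - (inner ℝ x d : ℝ) • x = 0 := by
    by_contra hne
    set s := d - (inner ℝ x d : ℝ) • x with hsdef
    have hxs : inner ℝ x s = 0 := by
      rw [hsdef, inner_sub_right, realHyp_inner_smul_right, real_inner_self_eq_norm_sq, hx]; ring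
    have hns : ‖s‖ ≠ 0 := norm_ne_zero_iff.2 hne
    have h := horth (‖s‖⁻¹ • s) (by rw [norm_smul, norm_inv, norm_norm, inv_mul_cancel₀ hns])
      (by rw [realHyp_inner_smul_right, hxs, mul_zero])
    rw [realHyp_inner_smul_left, show d = s + (inner ℝ x d : ℝ) • x by rw [hsdef]; abel,
      inner_add_right, realHyp_inner_smul_right, real_inner_comm x s, hxs, mul_zero, add_zero,
      real_inner_self_eq_norm_sq] at h
    have : ‖s‖ ^ 2 = 0 := (mul_eq_zero.1 h).resolve_left (inv_ne_zero hns)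
    exact hns (pow_eq_zero_iff two_ne_zero |>.1 this)
  have h := congrArg (fun y : RealHyp n => (y : EuclideanSpace ℝ (Fin (n + 2))) j) hd0
  simp only [hd, Submodule.coe_sub, Submodule.coe_smul, PiLp.sub_apply, PiLp.smul_apply, hj,
    smul_eq_mul, mul_zero, sub_zero, Submodule.coe_zero, PiLp.zero_apply, hβ] at h
  linarith

/-- Homogeneous coordinates of `i_ε (x)`, the perturbation of the double cover along the graph of
`ε df`. -/
def perturbed {n : ℕ} (W : WeinsteinNbhd n) (f : RealHyp n → ℝ) (ε : ℝ) (x : Sph n) :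
    Fin (n + 2) → ℂ :=
  W.toFun ((x : RealHyp n), ε • sphereGrad f (x : RealHyp n))

lemma norm_sph {n : ℕ} (x : Sph n) : ‖(x : RealHyp n)‖ = 1 := by
  simp

section

variable {n : ℕ} (W : WeinsteinNbhd n) {f : RealHyp n → ℝ}

lemma perturbed_zero (f : RealHyp n → ℝ) (x : Sph n) (j : Fin (n + 2)) :
    perturbed W f 0 x j = ((((x : RealHyp n) : EuclideanSpace ℝ (Fin (n + 2))) j : ℝ) : ℂ) := by
  rw [perturbed, zero_smul]
  exact W.zero_section _ (norm_sph x) j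

lemma continuous_graph (hf : ContDiff ℝ ∞ f) : Continuous fun p : ℝ × Sph n =>
    ((p.2 : RealHyp n), p.1 • sphereGrad f (p.2 : RealHyp n)) := by
  have := continuous_sphereGrad hf
  fun_prop

lemma eventually_mem_discBundle (hf : ContDiff ℝ ∞ f) (y : Sph n) :
    ∀ᶠ p : ℝ × Sph n in 𝓝 (0, y),
      ((p.2 : RealHyp n), p.1 • sphereGrad f (p.2 : RealHyp n)) ∈ discBundle n W.η := by
  have h : Continuous fun p : ℝ × Sph n => ‖p.1 • sphereGrad f (p.2 : RealHyp n)‖ :=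
    (continuous_graph hf).snd.norm
  have hev := h.continuousAt.eventually_lt (x₀ := ((0 : ℝ), y)) (continuousAt_const (y := W.η))
    (by simpa using W.η_pos)
  exact hev.mono fun p hp => smul_mem_discBundle (norm_sph _) (inner_sphereGrad f (norm_sph _)) hp

lemma continuousAt_perturbed (hf : ContDiff ℝ ∞ f) {p : ℝ × Sph n}
    (hp : ((p.2 : RealHyp n), p.1 • sphereGrad f (p.2 : RealHyp n)) ∈ discBundle n W.η) :
    ContinuousAt (fun p : ℝ × Sph n => perturbed W f p.1 p.2) p :=
  ContinuousAt.comp (f := fun p : ℝ × Sph n =>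
      ((p.2 : RealHyp n), p.1 • sphereGrad f (p.2 : RealHyp n)))
    (W.smooth _ hp).continuousAt (continuous_graph hf).continuousAt

lemma tendsto_perturbed (hf : ContDiff ℝ ∞ f) (y : Sph n) (j : Fin (n + 2)) :
    Tendsto (fun p : ℝ × Sph n => perturbed W f p.1 p.2 j) (𝓝 (0, y))
      (𝓝 ((((y : RealHyp n) : EuclideanSpace ℝ (Fin (n + 2))) j : ℝ) : ℂ)) := by
  have h := continuousAt_perturbed W hf (eventually_mem_discBundle W hf y).self_of_nhds
  have := (continuous_apply j).continuousAt.tendsto.comp h.tendsto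
  simp only [perturbed_zero] at this
  exact this

/-- The coordinates that vanish at `y` move into the upper half plane: the gradient of the
potential is their velocity. -/
lemma eventually_im_pos (hf : IsPotential f) (y : Sph n) {j : Fin (n + 2)}
    (hj : ((y : RealHyp n) : EuclideanSpace ℝ (Fin (n + 2))) j = 0) :
    ∀ᶠ p : ℝ × Sph n in 𝓝 (0, y), 0 < p.1 → 0 < (perturbed W f p.1 p.2 j).im := by
  let G : ℝ × Sph n → ℝ := fun p =>
    (fderiv ℝ W.toFun ((p.2 : RealHyp n), p.1 • sphereGrad f (p.2 : RealHyp n))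
      (0, sphereGrad f (p.2 : RealHyp n)) j).im
  have hdisc := eventually_mem_discBundle W hf.1 y
  have hG0 : 0 < G (0, y) := by
    simp only [G, zero_smul]
    rw [W.fderiv_vertical_im (norm_sph y) (inner_sphereGrad f (norm_sph y)) hj]
    exact hf.2 _ (norm_sph y) j hj
  have hGc : ContinuousAt G (0, y) := by
    have h1 : ContinuousAt (fderiv ℝ W.toFun)
        ((y : RealHyp n), (0 : ℝ) • sphereGrad f (y : RealHyp n)) :=
      ((W.smooth _ hdisc.self_of_nhds).fderiv_right (m := 0) (by simp)).continuousAt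
    have h2 : ContinuousAt (fun p : ℝ × Sph n => fderiv ℝ W.toFun
        ((p.2 : RealHyp n), p.1 • sphereGrad f (p.2 : RealHyp n))) (0, y) :=
      ContinuousAt.comp (f := fun p : ℝ × Sph n =>
        ((p.2 : RealHyp n), p.1 • sphereGrad f (p.2 : RealHyp n))) h1
        (continuous_graph hf.1).continuousAt
    have h3 : Continuous fun p : ℝ × Sph n =>
        ((0 : RealHyp n), sphereGrad f (p.2 : RealHyp n)) := by
      have := continuous_sphereGrad hf.1
      fun_prop
    have h4 := h2.clm_apply h3.continuousAt
    exact Complex.continuous_im.continuousAt.comp ((continuous_apply j).continuousAt.comp h4)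
  have hev := (hGc.eventually (lt_mem_nhds hG0)).and hdisc
  obtain ⟨u, hu, v, hv, huv⟩ := mem_nhds_prod_iff.1 hev
  obtain ⟨r, hr, hru⟩ := Metric.mem_nhds_iff.1 hu
  refine mem_nhds_prod_iff.2 ⟨Metric.ball 0 r, Metric.ball_mem_nhds _ hr, v, hv, ?_⟩
  rintro ⟨ε, x⟩ ⟨hε, hx⟩ hε0
  simp only at hε hx hε0 ⊢
  have hε' : ε < r := by simpa [abs_of_pos hε0] using hε
  have hin : ∀ t ∈ Icc 0 ε, 0 < G (t, x) ∧
      ((x : RealHyp n), t • sphereGrad f (x : RealHyp n)) ∈ discBundle n W.η := by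
    intro t ht
    refine huv (mk_mem_prod (hru ?_) hx)
    rw [Metric.mem_ball, dist_zero_right, Real.norm_of_nonneg ht.1]
    exact ht.2.trans_lt hε'
  have hder : ∀ t ∈ Icc 0 ε, HasDerivAt (fun t => (perturbed W f t x j).im) (G (t, x)) t := by
    intro t ht
    have h := hasDerivAt_pi.1 (W.hasDerivAt_vertical (hin t ht).2) j
    exact Complex.imCLM.hasFDerivAt.comp_hasDerivAt t h
  obtain ⟨c, hc, hc'⟩ := exists_hasDerivAt_eq_slope _ _ hε0
    (fun t ht => (hder t ht).continuousAt.continuousWithinAt)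
    (fun t ht => hder t (Ioo_subset_Icc_self ht))
  have hpos := (hin c (Ioo_subset_Icc_self hc)).1
  rw [hc', perturbed_zero, Complex.ofReal_im, sub_zero, sub_zero] at hpos
  exact (div_pos_iff_of_pos_right hε0).1 hpos

lemma eventually_branchArg_of_pos (hf : ContDiff ℝ ∞ f) (y : Sph n) {j : Fin (n + 2)}
    (hj : 0 < ((y : RealHyp n) : EuclideanSpace ℝ (Fin (n + 2))) j) {δ : ℝ} (hδ : 0 < δ) :
    ∀ᶠ p : ℝ × Sph n in 𝓝 (0, y), perturbed W f p.1 p.2 j ∈ cutPlane ∧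
      |branchArg (perturbed W f p.1 p.2 j)| < δ := by
  have ht := tendsto_perturbed W hf y j
  have hc : ((((y : RealHyp n) : EuclideanSpace ℝ (Fin (n + 2))) j : ℝ) : ℂ) ∈ cutPlane :=
    mem_cutPlane.2 (Or.inr (by simpa using hj.ne'))
  refine (ht.eventually (isOpen_cutPlane.mem_nhds hc)).and ?_
  have h := ((continuousAt_branchArg hc).tendsto.comp ht).abs
  rw [branchArg_ofReal_pos hj, abs_zero] at h
  exact h.eventually (gt_mem_nhds hδ)

lemma eventually_branchArg_of_neg (hf : ContDiff ℝ ∞ f) (y : Sph n) {j : Fin (n + 2)}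
    (hj : ((y : RealHyp n) : EuclideanSpace ℝ (Fin (n + 2))) j < 0) {δ : ℝ} (hδ : 0 < δ) :
    ∀ᶠ p : ℝ × Sph n in 𝓝 (0, y), perturbed W f p.1 p.2 j ∈ cutPlane ∧
      |branchArg (perturbed W f p.1 p.2 j) - Real.pi| < δ := by
  have ht := tendsto_perturbed W hf y j
  have hc : ((((y : RealHyp n) : EuclideanSpace ℝ (Fin (n + 2))) j : ℝ) : ℂ) ∈ cutPlane :=
    mem_cutPlane.2 (Or.inr (by simpa using hj.ne))
  refine (ht.eventually (isOpen_cutPlane.mem_nhds hc)).and ?_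
  have h := (((continuousAt_branchArg hc).tendsto.comp ht).sub_const Real.pi).abs
  rw [branchArg_ofReal_neg hj, sub_self, abs_zero] at h
  exact h.eventually (gt_mem_nhds hδ)

lemma exists_coord_pos {x : RealHyp n} (hx : x ≠ 0) :
    ∃ i, 0 < (x : EuclideanSpace ℝ (Fin (n + 2))) i := by
  by_contra! h
  apply hx
  have h1 := (Finset.sum_eq_zero_iff_of_nonpos fun i _ => h i).1 x.2
  ext i
  simpa using h1 i (Finset.mem_univ i)

lemma exists_coord_neg {x : RealHyp n} (hx : x ≠ 0) :
    ∃ i, (x : EuclideanSpace ℝ (Fin (n + 2))) i < 0 := by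
  obtain ⟨i, hi⟩ := exists_coord_pos (neg_ne_zero.2 hx)
  exact ⟨i, by simpa using hi⟩

lemma eventually_nearlyReal (hf : IsPotential f) {δ : ℝ} (hδ : 0 < δ) :
    ∀ᶠ ε : ℝ in 𝓝 0, ∀ x : Sph n, 0 < ε →
      ((x : RealHyp n), ε • sphereGrad f (x : RealHyp n)) ∈ discBundle n W.η ∧
        NearlyReal δ (perturbed W f ε x) := by
  have hloc : ∀ y : Sph n, ∀ᶠ p : ℝ × Sph n in 𝓝 (0, y), 0 < p.1 →
      ((p.2 : RealHyp n), p.1 • sphereGrad f (p.2 : RealHyp n)) ∈ discBundle n W.η ∧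
        NearlyReal δ (perturbed W f p.1 p.2) := by
    intro y
    have hcoord : ∀ j, ∀ᶠ p : ℝ × Sph n in 𝓝 (0, y), 0 < p.1 →
        perturbed W f p.1 p.2 j ∈ cutPlane ∧
          branchArg (perturbed W f p.1 p.2 j) ∈ Ioo (-δ) (Real.pi + δ) := by
      intro j
      have hp := Real.pi_pos
      rcases lt_trichotomy (((y : RealHyp n) : EuclideanSpace ℝ (Fin (n + 2))) j) 0 with h | h | h
      · filter_upwards [eventually_branchArg_of_neg W hf.1 y h hδ] with p hp' _
        have := abs_lt.1 hp'.2
        exact ⟨hp'.1, by linarith [this.1], by linarith [this.2]⟩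
      · filter_upwards [eventually_im_pos W hf y h] with p hp' h0
        have h1 := branchArg_mem_of_im_pos (hp' h0)
        exact ⟨mem_cutPlane.2 (Or.inl (hp' h0)), by linarith [h1.1], by linarith [h1.2]⟩
      · filter_upwards [eventually_branchArg_of_pos W hf.1 y h hδ] with p hp' _
        have := abs_lt.1 hp'.2
        exact ⟨hp'.1, by linarith [this.1], by linarith [this.2]⟩
    have hy0 : (y : RealHyp n) ≠ 0 := norm_ne_zero_iff.1 (by rw [norm_sph]; exact one_ne_zero)
    obtain ⟨i, hi⟩ := exists_coord_pos hy0
    obtain ⟨k, hk⟩ := exists_coord_neg hy0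
    filter_upwards [eventually_all.2 hcoord, eventually_mem_discBundle W hf.1 y,
      eventually_branchArg_of_pos W hf.1 y hi hδ, eventually_branchArg_of_neg W hf.1 y hk hδ]
      with p h1 h2 h3 h4 h0
    exact ⟨h2, fun j => h1 j h0, ⟨i, h3.2⟩, k, h4.2⟩
  have := isCompact_univ.eventually_forall_of_forall_eventually (x₀ := (0 : ℝ)) (K := univ)
    (P := fun ε (x : Sph n) => 0 < ε →
      ((x : RealHyp n), ε • sphereGrad f (x : RealHyp n)) ∈ discBundle n W.η ∧
        NearlyReal δ (perturbed W f ε x)) fun y _ => hloc y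
  exact this.mono fun ε h x => h x (mem_univ x)

lemma isSphereLift_liftMap (hf : ContDiff ℝ ∞ f) {ε δ : ℝ}
    (h : ∀ x : Sph n, ((x : RealHyp n), ε • sphereGrad f (x : RealHyp n)) ∈ discBundle n W.η ∧
      NearlyReal δ (perturbed W f ε x)) :
    IsSphereLift W f ε fun x => liftMap (perturbed W f ε x) := by
  refine ⟨continuous_iff_continuousAt.2 fun x => ?_, fun x => ?_⟩
  · refine ContinuousAt.comp (f := perturbed W f ε)
      (continuousAt_liftMap fun j => ((h x).2.1 j).1) ?_
    exact ContinuousAt.comp (f := fun x : Sph n => (ε, x)) (x := x)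
      (continuousAt_perturbed W hf (p := (ε, x)) (h x).1) (by fun_prop)
  · have hne : ∀ j, perturbed W f ε x j ≠ 0 := fun j => ne_zero_of_mem_cutPlane ((h x).2.1 j).1
    have hsum : ∑ j, perturbed W f ε x j = 0 := W.mem_hyp _ (h x).1
    exact ⟨liftMap_mem_Mbar0 hne hsum, (h x).1, W.ne_zero _ (h x).1, cover_liftMap hne hsum _⟩

end

/-! ### Uniqueness of the lift -/

/-- The vector `(-(n + 1), 1, …, 1)` of the real hyperplane. -/
def axisVec (n : ℕ) : RealHyp n :=
  ⟨WithLp.toLp 2 (Fin.cons (α := fun _ => ℝ) (-((n : ℝ) + 1)) fun _ => 1), by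
    change ∑ i, Fin.cons (α := fun _ => ℝ) (-((n : ℝ) + 1)) (fun _ => 1) i = 0
    rw [Fin.sum_univ_succ]; simp⟩

lemma axisVec_succ (n : ℕ) (i : Fin (n + 1)) :
    (axisVec n : EuclideanSpace ℝ (Fin (n + 2))) i.succ = 1 := rfl

lemma axisVec_ne_zero (n : ℕ) : axisVec n ≠ 0 := by
  intro h
  have := axisVec_succ n 0
  rw [h] at this
  simp at this

/-- A point of the sphere with negative first coordinate and all others positive. -/
def axisPt (n : ℕ) : Sph n :=
  ⟨‖axisVec n‖⁻¹ • axisVec n, by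
    have := norm_ne_zero_iff.2 (axisVec_ne_zero n)
    rw [mem_sphere_zero_iff_norm, norm_smul, norm_inv, norm_norm, inv_mul_cancel₀ this]⟩

lemma axisPt_zero_neg (n : ℕ) :
    ((axisPt n : RealHyp n) : EuclideanSpace ℝ (Fin (n + 2))) 0 < 0 := by
  have h : 0 < ‖axisVec n‖ := norm_pos_iff.2 (axisVec_ne_zero n)
  have : ((axisPt n : RealHyp n) : EuclideanSpace ℝ (Fin (n + 2))) 0 =
      ‖axisVec n‖⁻¹ * -((n : ℝ) + 1) := rfl
  rw [this]
  exact mul_neg_of_pos_of_neg (inv_pos.2 h) (by linarith [n.cast_nonneg (α := ℝ)])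

lemma axisPt_succ_pos (n : ℕ) (i : Fin (n + 1)) :
    0 < ((axisPt n : RealHyp n) : EuclideanSpace ℝ (Fin (n + 2))) i.succ := by
  have h : 0 < ‖axisVec n‖ := norm_pos_iff.2 (axisVec_ne_zero n)
  have : ((axisPt n : RealHyp n) : EuclideanSpace ℝ (Fin (n + 2))) i.succ =
      ‖axisVec n‖⁻¹ * 1 := rfl
  rw [this]
  positivity

lemma neg_sph_apply {n : ℕ} (x : Sph n) (j : Fin (n + 2)) :
    (((-x : Sph n) : RealHyp n) : EuclideanSpace ℝ (Fin (n + 2))) j =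
      -((x : RealHyp n) : EuclideanSpace ℝ (Fin (n + 2))) j := rfl

lemma torusProj_zonoMap_axis (n : ℕ) :
    torusProj (zonoMap (Fin.cons (α := fun _ => ℝ) Real.pi fun _ => 0 : Fin (n + 2) → ℝ)) =
      thimblePt n (exceptionalAngle n) := by
  have hn : (n : ℝ) + 2 ≠ 0 := by positivity
  ext i
  simp only [torusProj, zonoMap, Fin.sum_univ_succ (n := n + 1), Fin.cons_zero, Fin.cons_succ,
    Finset.sum_const_zero, add_zero, thimblePt, exceptionalAngle]
  refine Fin.cases ?_ (fun j => ?_) i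
  · simp only [Fin.castSucc_zero, Fin.cons_zero, if_true]
    congr 1
    field_simp
    ring
  · simp only [← Fin.succ_castSucc, Fin.cons_succ, Fin.succ_ne_zero, if_false,
      ← Real.Angle.coe_add]
    refine Real.Angle.angle_eq_iff_two_pi_dvd_sub.2 ⟨-1, ?_⟩
    push_cast
    field_simp
    ring

lemma torusProj_zonoMap_neg_axis (n : ℕ) :
    torusProj (zonoMap (Fin.cons (α := fun _ => ℝ) 0 fun _ => Real.pi : Fin (n + 2) → ℝ)) =
      thimblePt n (-exceptionalAngle n) := by
  have hn : (n : ℝ) + 2 ≠ 0 := by positivity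
  ext i
  simp only [torusProj, zonoMap, Fin.sum_univ_succ (n := n + 1), Fin.cons_zero, Fin.cons_succ,
    Finset.sum_const, Finset.card_univ, Fintype.card_fin, nsmul_eq_mul, thimblePt,
    exceptionalAngle, ← Real.Angle.coe_neg]
  refine Fin.cases ?_ (fun j => ?_) i
  · simp only [Fin.castSucc_zero, Fin.cons_zero, if_true]
    congr 1
    push_cast
    field_simp
    ring
  · simp only [← Fin.succ_castSucc, Fin.cons_succ, Fin.succ_ne_zero, if_false,
      ← Real.Angle.coe_add]
    congr 1
    push_cast
    field_simp
    ring

section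

variable {n : ℕ} (W : WeinsteinNbhd n) {f : RealHyp n → ℝ}

/-- If all coordinates of `y` are non-zero, the arguments of the lift converge at `y`. -/
lemma eventually_dist_argMap_lt (hf : ContDiff ℝ ∞ f) (y : Sph n) (ψ : Fin (n + 2) → ℝ)
    (hψ : ∀ j, (0 < ((y : RealHyp n) : EuclideanSpace ℝ (Fin (n + 2))) j ∧ ψ j = 0) ∨
      (((y : RealHyp n) : EuclideanSpace ℝ (Fin (n + 2))) j < 0 ∧ ψ j = Real.pi))
    {δ : ℝ} (hδ : 0 < δ) :
    ∀ᶠ ε : ℝ in 𝓝 0,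
      dist (argMap (liftMap (perturbed W f ε y))) (torusProj (zonoMap ψ)) < δ := by
  have h : ∀ j, ∀ᶠ p : ℝ × Sph n in 𝓝 (0, y), perturbed W f p.1 p.2 j ∈ cutPlane ∧
      |branchArg (perturbed W f p.1 p.2 j) - ψ j| < δ / 3 := by
    intro j
    rcases hψ j with ⟨h1, h2⟩ | ⟨h1, h2⟩
    · simpa only [h2, sub_zero] using eventually_branchArg_of_pos W hf y h1 (by positivity)
    · simpa only [h2] using eventually_branchArg_of_neg W hf y h1 (by positivity)
  have ht : Tendsto (fun ε : ℝ => (ε, y)) (𝓝 0) (𝓝 (0, y)) :=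
    (Continuous.prodMk continuous_id continuous_const).tendsto 0
  filter_upwards [ht.eventually (eventually_all.2 h)] with ε hε
  rw [argMap_liftMap fun j => ne_zero_of_mem_cutPlane (hε j).1]
  exact (dist_torusProj_zonoMap_le fun j => (hε j).2.le).trans_lt (by linarith)

lemma eventually_dist_argMap_axis (hf : ContDiff ℝ ∞ f) {δ : ℝ} (hδ : 0 < δ) :
    ∀ᶠ ε : ℝ in 𝓝 0,
      dist (argMap (liftMap (perturbed W f ε (axisPt n)))) (thimblePt n (exceptionalAngle n)) < δ ∧
      dist (argMap (liftMap (perturbed W f ε (-axisPt n)))) (thimblePt n (-exceptionalAngle n)) <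
        δ := by
  rw [← torusProj_zonoMap_axis, ← torusProj_zonoMap_neg_axis]
  refine (eventually_dist_argMap_lt W hf _ _ (fun j => ?_) hδ).and
    (eventually_dist_argMap_lt W hf _ _ (fun j => ?_) hδ)
  · refine Fin.cases ?_ (fun i => ?_) j
    · exact Or.inr ⟨axisPt_zero_neg n, rfl⟩
    · exact Or.inl ⟨axisPt_succ_pos n i, rfl⟩
  · rw [neg_sph_apply]
    refine Fin.cases ?_ (fun i => ?_) j
    · exact Or.inl ⟨neg_pos.2 (axisPt_zero_neg n), rfl⟩
    · exact Or.inr ⟨neg_neg_iff_pos.2 (axisPt_succ_pos n i), rfl⟩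

end

lemma isPreconnected_sph {n : ℕ} (hn : 1 ≤ n) : IsPreconnected (univ : Set (Sph n)) := by
  have hrank : 1 < Module.rank ℝ (RealHyp n) := by
    let φ : EuclideanSpace ℝ (Fin (n + 2)) →ₗ[ℝ] ℝ :=
      { toFun := fun x => ∑ i, x i
        map_add' := fun x y => by simp [Finset.sum_add_distrib]
        map_smul' := fun c x => by simp [Finset.mul_sum] }
    have hker : LinearMap.ker φ = RealHyp n := rfl
    have h1 := φ.finrank_range_add_finrank_ker
    have h2 : Module.finrank ℝ (LinearMap.range φ) ≤ 1 := by
      simpa using (LinearMap.range φ).finrank_le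
    rw [hker, finrank_euclideanSpace, Fintype.card_fin] at h1
    rw [← Module.finrank_eq_rank]
    exact_mod_cast (by omega : 1 < Module.finrank ℝ (RealHyp n))
  exact (Subtype.preconnectedSpace
    (isPreconnected_sphere hrank (0 : RealHyp n) 1)).isPreconnected_univ

/-- Two continuous lifts differ by a constant root of unity. -/
lemma IsSphereLift.exists_eq_smul {n : ℕ} (hn : 1 ≤ n) {W : WeinsteinNbhd n} {f : RealHyp n → ℝ}
    {ε : ℝ} {σ τ : Sph n → Fin (n + 2) → ℂ} (hσ : IsSphereLift W f ε σ)
    (hτ : IsSphereLift W f ε τ) : ∃ c : ℂ, c ^ (n + 2) = 1 ∧ ∀ x, τ x = c • σ x := by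
  have hne : ∀ x j, σ x j ≠ 0 := fun x j => ne_zero_of_mem_Mbar0 (hσ.2 x).1 j
  have hloc : ∀ x, (τ x 0 / σ x 0) ^ (n + 2) = 1 ∧ τ x = (τ x 0 / σ x 0) • σ x := by
    intro x
    obtain ⟨h1, -, hz, h2⟩ := hσ.2 x
    obtain ⟨h3, -, hz', h4⟩ := hτ.2 x
    obtain ⟨_, h5⟩ := cover_eq_mk h1
    obtain ⟨_, h6⟩ := cover_eq_mk h3
    obtain ⟨a, ha⟩ := (Projectivization.mk_eq_mk_iff' ℂ _ _ _ _).1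
      (h6.symm.trans (h4.trans (h2.symm.trans h5)))
    have ha0 : τ x 0 / σ x 0 = a := by
      rw [← ha, Pi.smul_apply, smul_eq_mul, mul_div_cancel_right₀ _ (hne x 0)]
    rw [ha0]
    refine ⟨?_, ha.symm⟩
    have := h3.1
    rw [← ha] at this
    simpa [Finset.prod_mul_distrib, h1.1] using this
  have hcont : Continuous fun x => τ x 0 / σ x 0 :=
    ((continuous_apply 0).comp hτ.1).div ((continuous_apply 0).comp hσ.1) fun x => hne x 0
  refine ⟨_, (hloc (axisPt n)).1, fun x => ?_⟩
  have := (isPreconnected_sph hn).constant_of_mapsTo (finite_pow_eq (n + 2) (by omega) 1).isDiscrete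
    hcont.continuousOn (fun x _ => (hloc x).1) (mem_univ x) (mem_univ (axisPt n))
  rw [(hloc x).2, this]

lemma argMap_smul {n : ℕ} {c : ℂ} (hc : c ≠ 0) {u : Fin (n + 2) → ℂ} (hu : ∀ j, u j ≠ 0) :
    argMap (c • u) = (fun _ => (c.arg : Real.Angle)) + argMap u := by
  ext i
  exact Complex.arg_mul_coe_angle hc (hu _)

lemma const_add_thimblePt {n : ℕ} (α a : Real.Angle) :
    (fun _ => α) + thimblePt n a = thimblePt n (α + a) := by
  ext i
  simp only [Pi.add_apply, thimblePt]
  split_ifs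
  · rfl
  · rw [add_assoc]

lemma nsmul_neg_exceptionalAngle (n : ℕ) :
    (n + 2) • (-exceptionalAngle n) = (n + 1) • ((Real.pi : ℝ) : Real.Angle) := by
  rw [smul_neg, nsmul_exceptionalAngle, neg_eq_iff_add_eq_zero, ← two_nsmul, smul_comm,
    Real.Angle.two_nsmul_coe_pi, smul_zero]

/-- A translation that permutes the two exceptional angles is trivial: otherwise `n + 2` would
divide `2`. -/
lemma eq_zero_of_add_exceptionalAngle {n : ℕ} (hn : 1 ≤ n) {α : Real.Angle}
    (h1 : α + exceptionalAngle n = exceptionalAngle n ∨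
      α + exceptionalAngle n = -exceptionalAngle n)
    (h2 : α + -exceptionalAngle n = exceptionalAngle n ∨
      α + -exceptionalAngle n = -exceptionalAngle n) : α = 0 := by
  rcases h1 with h1 | h1
  · simpa using h1
  rcases h2 with h2 | h2
  swap
  · simpa using h2
  exfalso
  have h4 : (4 : ℕ) • exceptionalAngle n = 0 := by
    have e1 : α = -exceptionalAngle n - exceptionalAngle n := eq_sub_of_add_eq h1
    have e2 : α = exceptionalAngle n + exceptionalAngle n := by
      rw [← sub_eq_add_neg] at h2; exact eq_add_of_sub_eq h2
    have : (4 : ℕ) • exceptionalAngle n = (exceptionalAngle n + exceptionalAngle n) -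
        (-exceptionalAngle n - exceptionalAngle n) := by
      rw [show (4 : ℕ) = 1 + 1 + 1 + 1 from rfl]; simp only [add_smul, one_smul]; abel
    rw [this, ← e1, ← e2, sub_self]
  rw [exceptionalAngle, ← Real.Angle.coe_nsmul, ← Real.Angle.coe_zero,
    Real.Angle.angle_eq_iff_two_pi_dvd_sub] at h4
  obtain ⟨k, hk⟩ := h4
  have hn2 : (n : ℝ) + 2 ≠ 0 := by positivity
  have hk' : 2 * ((n : ℝ) + 1) = ((n : ℝ) + 2) * k := by
    have hp := Real.pi_ne_zero
    simp only [nsmul_eq_mul] at hk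
    push_cast at hk
    field_simp at hk
    refine mul_right_cancel₀ (mul_ne_zero two_ne_zero hp) ?_
    linarith
  have hk2 : 2 * ((n : ℤ) + 1) = ((n : ℤ) + 2) * k := by exact_mod_cast hk'
  have hk3 : ((n : ℤ) + 2) * (2 - k) = 2 := by linarith
  have hdvd : ((n : ℤ) + 2) ∣ 2 := ⟨_, hk3.symm⟩
  have := Int.le_of_dvd (by norm_num) hdvd
  omega

/-- Near the boundary of the zonotope there is at most one lift: translating by a non-trivial root
of unity moves one of the two exceptional thimble points away from the zonotope. -/
lemma lift_unique {n : ℕ} (hn : 1 ≤ n) {W : WeinsteinNbhd n} {f : RealHyp n → ℝ}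
    {ε δ δ₀ : ℝ} (hδ : δ ≤ δ₀)
    (hdisj : Disjoint (Metric.thickening δ₀ (thimblePt n '' {a | (n + 2) • a = (n + 1) •
      ((Real.pi : ℝ) : Real.Angle) ∧ a ≠ exceptionalAngle n ∧ a ≠ -exceptionalAngle n}))
      (Metric.thickening δ₀ (torusProj '' zonotope n)))
    {σ τ : Sph n → Fin (n + 2) → ℂ} (hσ : IsSphereLift W f ε σ)
    (h1 : dist (argMap (σ (axisPt n))) (thimblePt n (exceptionalAngle n)) < δ₀)
    (h2 : dist (argMap (σ (-axisPt n))) (thimblePt n (-exceptionalAngle n)) < δ₀)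
    (hτ : IsLastSphere W f ε δ τ) : τ = σ := by
  obtain ⟨c, hc, hcσ⟩ := hσ.exists_eq_smul hn hτ.1
  have hnorm : ‖c‖ = 1 := by
    have := congrArg norm hc
    rw [norm_pow, norm_one] at this
    exact (pow_eq_one_iff_of_nonneg (norm_nonneg _) (by omega)).1 this
  have hc0 : c ≠ 0 := norm_ne_zero_iff.1 (by rw [hnorm]; exact one_ne_zero)
  have hα : (n + 2) • (c.arg : Real.Angle) = 0 := by
    rw [← Complex.arg_pow_coe_angle, hc, Complex.arg_one, Real.Angle.coe_zero]
  have key : ∀ (x : Sph n) (a : Real.Angle),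
      (n + 2) • a = (n + 1) • ((Real.pi : ℝ) : Real.Angle) →
      dist (argMap (σ x)) (thimblePt n a) < δ₀ →
      (c.arg : Real.Angle) + a = exceptionalAngle n ∨
        (c.arg : Real.Angle) + a = -exceptionalAngle n := by
    intro x a ha hx
    by_contra! hne
    have hmem := Metric.thickening_mono hδ _
      (Metric.thickening_subset_of_subset δ (torusProj_frontier_subset n) (hτ.2 x))
    refine Set.disjoint_left.1 hdisj (Metric.mem_thickening_iff.2 ⟨_, ⟨c.arg + a,
      ⟨by rw [smul_add, hα, zero_add, ha], hne⟩, rfl⟩, ?_⟩) hmem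
    rw [hcσ, argMap_smul hc0 fun j => ne_zero_of_mem_Mbar0 (hσ.2 x).1 j, ← const_add_thimblePt,
      dist_add_left]
    exact hx
  have harg := eq_zero_of_add_exceptionalAngle hn (key _ _ (nsmul_exceptionalAngle n) h1)
    (key _ _ (nsmul_neg_exceptionalAngle n) h2)
  have hc1 : c = 1 := by
    have h3 := congrArg Real.Angle.toReal harg
    rw [Complex.arg_coe_angle_toReal_eq_arg, Real.Angle.toReal_zero] at h3
    rw [← Complex.norm_mul_exp_arg_mul_I c, hnorm, h3]
    simp
  ext x j
  rw [hcσ, hc1, one_smul]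

end Pants

end

theorem mainTheorem11 (n : ℕ) (hn : 1 ≤ n) :
    (∀ ζ : ℂ, ζ ^ (n + 2) = (-1) ^ (n + 1) * ((n : ℂ) + 1) ^ (n + 1) →
      (∃! C : Set (Fin (n + 2) → ℂ), Pants.IsThimble n ζ C) ∧
      ∀ C : Set (Fin (n + 2) → ℂ), Pants.IsThimble n ζ C →
        Pants.argMap '' C = {Pants.torusProj
          (fun i => if i = 0 then Complex.arg ζ else Complex.arg ζ + Real.pi)} ∧
        (Complex.arg ζ ≠ ((n : ℝ) + 1) / ((n : ℝ) + 2) * Real.pi →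
          Complex.arg ζ ≠ -(((n : ℝ) + 1) / ((n : ℝ) + 2) * Real.pi) →
          Disjoint (Pants.argMap '' C) (Pants.torusProj '' Pants.zonotope n))) ∧
    (∃ δ₀ : ℝ, 0 < δ₀ ∧
      ∀ (W : Pants.WeinsteinNbhd n) (f : Pants.RealHyp n → ℝ), Pants.IsPotential f →
      ∀ δ : ℝ, 0 < δ → δ ≤ δ₀ → ∃ ε₀ : ℝ, 0 < ε₀ ∧ ∀ ε : ℝ, 0 < ε → ε < ε₀ →
        ∃ σ : Pants.Sph n → (Fin (n + 2) → ℂ),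
          Pants.IsLastSphere W f ε δ σ ∧
          (∀ τ : Pants.Sph n → (Fin (n + 2) → ℂ), Pants.IsLastSphere W f ε δ τ → τ = σ) ∧
          ∀ ζ : ℂ, ζ ^ (n + 2) = (-1) ^ (n + 1) * ((n : ℂ) + 1) ^ (n + 1) →
            Complex.arg ζ ≠ ((n : ℝ) + 1) / ((n : ℝ) + 2) * Real.pi →
            Complex.arg ζ ≠ -(((n : ℝ) + 1) / ((n : ℝ) + 2) * Real.pi) →
            ∀ C : Set (Fin (n + 2) → ℂ), Pants.IsThimble n ζ C →
              Disjoint C (Set.range σ)) := by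
  refine ⟨fun ζ hζ => ⟨⟨_, (Pants.isThimble_iff hζ).2 rfl,
    fun C hC => (Pants.isThimble_iff hζ).1 hC⟩, fun C hC => ?_⟩, ?_⟩
  · rw [(Pants.isThimble_iff hζ).1 hC, Pants.argMap_image_thimble hζ]
    refine ⟨?_, fun h1 h2 => ?_⟩
    · congr 1
      ext i
      simp only [Pants.thimblePt, Pants.torusProj]
      split_ifs
      · rfl
      · exact (Real.Angle.coe_add _ _).symm
    · rw [Set.disjoint_singleton_left]
      intro h
      exact (Pants.eq_exceptionalAngle_of_thimblePt_mem (Pants.nsmul_arg_of_pow_eq hζ) h).elim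
        (Pants.coe_arg_ne_exceptionalAngle h1) (Pants.coe_arg_ne_neg_exceptionalAngle h2)
  · obtain ⟨δ₀, hδ₀, hdisj⟩ := Pants.exists_thickening_disjoint n
    refine ⟨δ₀, hδ₀, fun W f hf δ hδ hδδ => ?_⟩
    have hd : 0 < min (δ / 3) 1 := lt_min (by positivity) one_pos
    obtain ⟨ε₀, hε₀, hball⟩ := Metric.eventually_nhds_iff.1
      ((Pants.eventually_nearlyReal W hf hd).and (Pants.eventually_dist_argMap_axis W hf.1 hδ₀))
    refine ⟨ε₀, hε₀, fun ε hε hεε => ?_⟩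
    obtain ⟨hnear, hax1, hax2⟩ := hball (y := ε) (by simpa [abs_of_pos hε] using hεε)
    have hlift := Pants.isSphereLift_liftMap W hf.1 fun x => hnear x hε
    have hlast : Pants.IsLastSphere W f ε δ fun x => Pants.liftMap (Pants.perturbed W f ε x) :=
      ⟨hlift, fun x => Metric.thickening_mono (by linarith [min_le_left (δ / 3) 1]) _
        ((hnear x hε).2.argMap_liftMap_mem (min_le_right _ _))⟩
    refine ⟨_, hlast, fun τ hτ => Pants.lift_unique hn hδδ hdisj hlift hax1 hax2 hτ, ?_⟩
    intro ζ hζ h1 h2 C hC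
    rw [(Pants.isThimble_iff hζ).1 hC, Set.disjoint_left]
    rintro _ hu ⟨x, rfl⟩
    have harg : Pants.argMap (Pants.liftMap (Pants.perturbed W f ε x)) =
        Pants.thimblePt n ζ.arg := by
      have := Set.mem_image_of_mem Pants.argMap hu
      rwa [Pants.argMap_image_thimble hζ] at this
    refine Set.disjoint_left.1 hdisj (Metric.self_subset_thickening hδ₀ _
      ⟨(ζ.arg : Real.Angle), ⟨Pants.nsmul_arg_of_pow_eq hζ, Pants.coe_arg_ne_exceptionalAngle h1,
        Pants.coe_arg_ne_neg_exceptionalAngle h2⟩, harg.symm⟩)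
      (Metric.thickening_mono hδδ _ (Metric.thickening_subset_of_subset δ
        (Pants.torusProj_frontier_subset n) (hlast.2 x)))
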